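/- **Setting.** Let $M$ be a von Neumann algebra ($W^*$-algebra) and let $E$ be a $W^*$-correspondence over $M$: a self-dual right Hilbert $C^*$-module over $M$ (inner product $M$-linear in the second variable) with a left action given by a normal $*$-homomorphism $\varphi:M\to\mathcal L(E)$ into the adjointable operators on $E$. Put $E^{\otimes 0}=M$ and let $\mathcal F(E)=E^{\otimes 0}\oplus E^{\otimes 1}\oplus E^{\otimes 2}\oplus\cdots$ be the full Fock space, formed as a self-dual Hilbert $C^*$-module over $M$ from the balanced tensor powers of $E$ (the self-dual completion of their algebraic direct sum), with its left action $\varphi_\infty:M\to\mathcal L(\mathcal F(E))$ and creation operators $T_\xi\zeta=\xi\otimes\zeta$, $\xi\in E$. The Hardy algebra $H^\infty(E)$ is the smallest ultraweakly closed subalgebra of $\mathcal L(\mathcal F(E))$ containing all $T_\xi$ $(\xi\in E)$ and all $\varphi_\infty(a)$ $(a\in M)$. Let $\sigma:M\to B(H)$ be a unital normal $*$-representation on a Hilbert space $H$. For a Hilbert module $F$ over $M$ let $F\otimes_\sigma H$ be the Hilbert space completion of $F\otimes H$ (modulo null vectors) for $\langle x\otimes h,y\otimes k\rangle=\langle h,\sigma(\langle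 x,y\rangle)k\rangle$; an adjointable $X$ on $F$ acts on it as $X\otimes I_H$. Let $E^\sigma$ be the space of bounded operators $\eta:H\to E\otimes_\sigma H$ with $\eta\sigma(a)=(\varphi(a)\otimes I_H)\eta$ for all $a\in M$, with the operator norm, and let $\mathbb D(E^\sigma)$ be its open unit ball. For $\eta\in\mathbb D(E^\sigma)$ put $$\widehat{\eta^*}(\xi)h=\eta^*(\xi\otimes h)\quad(\xi\in E,\ h\in H),\qquad \eta^{(0)}=I_H,\qquad \eta^{(n+1)}=(I_E\otimes\eta^{(n)})\eta,$$ where $\eta^{(n)}:H\to E^{\otimes n}\otimes_\sigma H\subseteq\mathcal F(E)\otimes_\sigma H$ and $M\otimes_\sigma H$ is identified with $H$ through $a\otimes h\mapsto\sigma(a)h$, and $$C(\eta)=[\eta^{(0)},\eta^{(1)},\eta^{(2)},\dots]^{\mathsf T}=\sum_{n\ge0}\eta^{(n)}:H\to\mathcal F(E)\otimes_\sigma H,$$ $$\Delta_*(\eta)=(I_H-\eta^*\eta)^{1/2},\qquad K(\eta)=(I_{\mathcal F(E)}\otimes\Delta_*(\eta))\,C(\eta).$$ **Theorem.** Let $\eta\in\mathbb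 D(E^\sigma)$. There is exactly one ultraweakly continuous algebra homomorphism $\sigma\times\widehat{\eta^*}:H^\infty(E)\to B(H)$ with $\varphi_\infty(a)\mapsto\sigma(a)$ for $a\in M$ and $T_\xi\mapsto\widehat{\eta^*}(\xi)$ for $\xi\in E$. For every $X\in H^\infty(E)$, the Fourier transform $\widehat X(\eta^*):=(\sigma\times\widehat{\eta^*})(X)$ satisfies $$K(\eta)\,\widehat X(\eta^*)^*=(X^*\otimes I_H)\,K(\eta)$$ and $$\widehat X(\eta^*)=K(\eta)^*\,(X\otimes I_H)\,K(\eta).$$ -/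

import Mathlib

open scoped ComplexOrder TensorProduct InnerProductSpace Topology

universe u v w w' w''

noncomputable section

namespace HardyPoisson

/-- A right (pre-)Hilbert C⋆-module `E` over a C⋆-algebra `M`: the right action of `a : M` is the
action of `MulOpposite.op a`, the `M`-valued inner product is `M`-linear in the second variable and
the norm of `E` is the one induced by the inner product. A Hilbert C⋆-module is such a module which
is moreover complete. -/
class HilbertModule (M : Type v) (E : Type u) [CStarAlgebra M] [PartialOrder M]
    [NormedAddCommGroup E] [NormedSpace ℂ E] [Module Mᵐᵒᵖ E] where
  /-- the `M`-valued inner product `⟨x, y⟩` -/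
  ip (M) : E → E → M
  ip_add_right : ∀ x y z, ip x (y + z) = ip x y + ip x z
  ip_smul_right : ∀ (c : ℂ) x y, ip x (c • y) = c • ip x y
  ip_rsmul_right : ∀ x y (a : M), ip x (MulOpposite.op a • y) = ip x y * a
  star_ip : ∀ x y, star (ip x y) = ip y x
  ip_self_nonneg : ∀ x, 0 ≤ ip x x
  norm_sq_eq : ∀ x, ‖x‖ ^ 2 = ‖ip x x‖

open HilbertModule

section Module

variable (M : Type v) {E : Type u} [CStarAlgebra M] [PartialOrder M]
  [NormedAddCommGroup E] [NormedSpace ℂ E] [Module Mᵐᵒᵖ E] [HilbertModule M E]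

theorem ip_add_left (x y z : E) : ip M (x + y) z = ip M x z + ip M y z := by
  rw [← star_ip, ip_add_right, star_add, star_ip, star_ip]

theorem ip_smul_left (c : ℂ) (x y : E) : ip M (c • x) y = star c • ip M x y := by
  rw [← star_ip, ip_smul_right, star_smul, star_ip]

theorem ip_rsmul_left (x y : E) (a : M) :
    ip M (MulOpposite.op a • x) y = star a * ip M x y := by
  rw [← star_ip, ip_rsmul_right, star_mul, star_ip]

theorem ip_zero_right (x : E) : ip M x 0 = 0 := by
  simpa using ip_smul_right (M := M) 0 x (0 : E)

theorem ip_zero_left (x : E) : ip M 0 x = 0 := by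
  rw [← star_ip, ip_zero_right, star_zero]

theorem ip_sub_right (x y z : E) : ip M x (y - z) = ip M x y - ip M x z := by
  have := ip_add_right (M := M) x (y - z) z
  rw [sub_add_cancel] at this
  rw [this, add_sub_cancel_right]

theorem ip_sub_left (x y z : E) : ip M (x - y) z = ip M x z - ip M y z := by
  rw [← star_ip, ip_sub_right, star_sub, star_ip, star_ip]

theorem ip_sum_right {ι : Type*} (s : Finset ι) (x : E) (y : ι → E) :
    ip M x (∑ i ∈ s, y i) = ∑ i ∈ s, ip M x (y i) := by
  classical
  induction s using Finset.induction_on with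
  | empty => simp [ip_zero_right]
  | insert i s hi ih => rw [Finset.sum_insert hi, Finset.sum_insert hi, ip_add_right, ih]

theorem ip_sum_left {ι : Type*} (s : Finset ι) (x : ι → E) (y : E) :
    ip M (∑ i ∈ s, x i) y = ∑ i ∈ s, ip M (x i) y := by
  rw [← star_ip, ip_sum_right, star_sum]
  simp only [star_ip]

theorem eq_zero_of_ip_self {x : E} (h : ip M x x = 0) : x = 0 := by
  have := norm_sq_eq (M := M) x
  rw [h, norm_zero] at this
  exact norm_eq_zero.mp (pow_eq_zero_iff (two_ne_zero) |>.mp this)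

theorem ip_ext {x y : E} (h : ∀ z, ip M z x = ip M z y) : x = y := by
  refine sub_eq_zero.mp (eq_zero_of_ip_self M ?_)
  rw [ip_sub_right, h, sub_self]

/-- Polarization. -/
theorem eq_zero_of_quadratic (T : E →L[ℂ] E) (h : ∀ x, ip M x (T x) = 0) : T = 0 := by
  have key : ∀ x y, ip M x (T y) = 0 := by
    intro x y
    have h1 := h (x + y)
    have h2 := h (x + Complex.I • y)
    simp only [map_add, map_smul, ip_add_left, ip_add_right, ip_smul_left, ip_smul_right, h,
      smul_zero, add_zero, zero_add] at h1 h2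
    have h3 : ip M y (T x) = - ip M x (T y) := eq_neg_of_add_eq_zero_left h1
    rw [h3] at h2
    simp only [RCLike.star_def, Complex.conj_I, smul_neg, neg_smul, neg_neg, ← two_smul ℂ,
      smul_smul] at h2
    rcases smul_eq_zero.mp h2 with h4 | h4
    · simp at h4
    · exact h4
  ext y
  exact ip_ext M fun z => by simp [key, ip_zero_right]

variable (E) in
/-- A Hilbert C⋆-module `E` over `M` is self-dual if every bounded `M`-module map `E → M` is of the
form `x ↦ ⟨y, x⟩` for some `y : E`. -/
def SelfDual : Prop :=
  ∀ τ : E →L[ℂ] M, (∀ x (a : M), τ (MulOpposite.op a • x) = τ x * a) → ∃ y : E, ∀ x, τ x = ip M y x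

variable (E) in
/-- `𝓛(E)`: the algebra of adjointable operators on `E`. (On a self-dual module, these
are exactly the bounded module maps.) -/
def Adjointable : Subalgebra ℂ (E →L[ℂ] E) where
  carrier := {T | ∃ S : E →L[ℂ] E, ∀ x y, ip M (T x) y = ip M x (S y)}
  mul_mem' := by
    rintro T T' ⟨S, hS⟩ ⟨S', hS'⟩
    exact ⟨S' * S, fun x y => by simp [hS, hS']⟩
  add_mem' := by
    rintro T T' ⟨S, hS⟩ ⟨S', hS'⟩
    exact ⟨S + S', fun x y => by simp [hS, hS', ip_add_left, ip_add_right]⟩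
  algebraMap_mem' := fun c =>
    ⟨algebraMap ℂ _ (star c), fun x y => by
      simp [Algebra.algebraMap_eq_smul_one, ip_smul_left, ip_smul_right]⟩

namespace Adjointable

variable {M}

/-- The adjoint operator. -/
instance : Star (Adjointable M E) where
  star T := ⟨T.2.choose, T.1, fun x y => by
    rw [← star_ip, ← T.2.choose_spec, star_ip]⟩

theorem ip_left (T : Adjointable M E) (x y : E) :
    ip M (T.1 x) y = ip M x ((star T).1 y) := T.2.choose_spec x y

theorem ip_right (T : Adjointable M E) (x y : E) :
    ip M x (T.1 y) = ip M ((star T).1 x) y := by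
  rw [← star_ip, ip_left, star_ip]

theorem eq_star {T S : Adjointable M E} (h : ∀ x y, ip M (T.1 x) y = ip M x (S.1 y)) :
    S = star T := by
  apply Subtype.ext
  ext y
  exact ip_ext M fun z => by rw [← h, ip_left]

instance : StarRing (Adjointable M E) where
  star_involutive T := (eq_star fun x y => (ip_right T x y).symm).symm
  star_mul S T := (eq_star fun x y => by
    change ip M (S.1 (T.1 x)) y = ip M x ((star T).1 ((star S).1 y))
    rw [ip_left, ip_left]).symm
  star_add S T := (eq_star fun x y => by
    change ip M (S.1 x + T.1 x) y = ip M x ((star S).1 y + (star T).1 y)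
    rw [ip_add_left, ip_add_right, ip_left, ip_left]).symm

theorem star_one : star (1 : Adjointable M E) = 1 := (eq_star fun _ _ => rfl).symm

/-- Adjointable operators are module maps. -/
theorem map_rsmul (T : Adjointable M E) (x : E) (a : M) :
    T.1 (MulOpposite.op a • x) = MulOpposite.op a • T.1 x :=
  ip_ext M fun z => by rw [ip_right, ip_rsmul_right, ip_rsmul_right, ip_right]

/-- The order of the C⋆-algebra `𝓛(E)`: `S ≤ T` iff `⟨x, (T - S) x⟩ ≥ 0` for all `x`. -/
instance [StarOrderedRing M] : PartialOrder (Adjointable M E) where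
  le S T := ∀ x : E, 0 ≤ ip M x ((T - S).1 x)
  le_refl S x := by simp [ip_zero_right]
  le_trans S T U h h' x := by
    have := add_nonneg (h x) (h' x)
    rw [← ip_add_right] at this
    convert this using 2
    simp
  le_antisymm S T h h' := by
    have : (T - S).1 = 0 := eq_zero_of_quadratic M _ fun x => by
      refine le_antisymm ?_ (h x)
      have h1 := h' x
      have h2 : (S - T).1 x = 0 - (T - S).1 x := by simp
      rw [h2, ip_sub_right, ip_zero_right, zero_sub] at h1
      exact neg_nonneg.mp h1
    exact (sub_eq_zero.mp (Subtype.ext this)).symm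

end Adjointable

end Module

/-- A ⋆-representation of `M` on a Hilbert space (bundled). -/
structure Rep (M : Type v) [CStarAlgebra M] where
  /-- the Hilbert space -/
  space : Type w
  [normed : NormedAddCommGroup space]
  [inner : InnerProductSpace ℂ space]
  [complete : CompleteSpace space]
  /-- the action of `M` -/
  act : M →⋆ₙₐ[ℂ] (space →L[ℂ] space)

attribute [instance] Rep.normed Rep.inner Rep.complete

section Representations

variable {M : Type v} [CStarAlgebra M]

/-- The bounded operators `S` with `S σ(a) = σ'(a) S` for all `a`. -/
def Intertwiner (R : Rep.{v, w} M) (R' : Rep.{v, w'} M) : Submodule ℂ (R.space →L[ℂ] R'.space) where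
  carrier := {S | ∀ a : M, S ∘L R.act a = R'.act a ∘L S}
  add_mem' h h' a := by
    rw [ContinuousLinearMap.add_comp, ContinuousLinearMap.comp_add, h a, h' a]
  zero_mem' a := by simp
  smul_mem' c S h a := by
    rw [ContinuousLinearMap.smul_comp, ContinuousLinearMap.comp_smul, h a]

namespace Intertwiner

variable {R : Rep.{v, w} M} {R' : Rep.{v, w'} M}

theorem apply (S : Intertwiner R R') (a : M) (h : R.space) :
    S.1 (R.act a h) = R'.act a (S.1 h) := congrArg (fun T => T h) (S.2 a)

/-- The identity intertwiner. -/
def id (R : Rep.{v, w} M) : Intertwiner R R :=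
  ⟨ContinuousLinearMap.id ℂ R.space, fun a => by ext; simp⟩

/-- The adjoint of an intertwiner. -/
def adj (S : Intertwiner R R') : Intertwiner R' R :=
  ⟨ContinuousLinearMap.adjoint S.1, fun a => by
    have h := congrArg ContinuousLinearMap.adjoint (S.2 (star a))
    rw [ContinuousLinearMap.adjoint_comp, ContinuousLinearMap.adjoint_comp,
      ← ContinuousLinearMap.star_eq_adjoint (R.act (star a)),
      ← ContinuousLinearMap.star_eq_adjoint (R'.act (star a)), ← map_star, ← map_star,
      star_star] at h
    exact h.symm⟩

end Intertwiner

section Positivity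

variable [PartialOrder M] [StarOrderedRing M] {E : Type u}
  [NormedAddCommGroup E] [NormedSpace ℂ E] [Module Mᵐᵒᵖ E] [HilbertModule M E]


theorem exists_negPart {B : Type*} [CStarAlgebra B] (G : B) (hG : IsSelfAdjoint G) :
    ∃ N C : B, star N * G * N = -(star C * C) ∧ (C = 0 → ∃ D : B, G = star D * D) := by
  let _ : PartialOrder B := CStarAlgebra.spectralOrder _
  have _ : StarOrderedRing B := CStarAlgebra.spectralOrderedRing _
  have hn : 0 ≤ G⁻ := CFC.negPart_nonneg G
  have hs : star G⁻ = G⁻ := hn.isSelfAdjoint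
  have h1 : star G⁻ * G * G⁻ = -(star G⁻ * G⁻ * G⁻) := by
    have h1 : G⁺ - G⁻ = G := CFC.posPart_sub_negPart G hG
    calc star G⁻ * G * G⁻ = G⁻ * (G⁺ - G⁻) * G⁻ := by rw [hs, h1]
      _ = -(star G⁻ * G⁻ * G⁻) := by
        rw [mul_sub, sub_mul, hs, CFC.negPart_mul_posPart, zero_mul, zero_sub]
  have h2 : 0 ≤ star G⁻ * G⁻ * G⁻ := by
    conv_rhs => rw [hs]
    simpa [hs] using star_left_conjugate_nonneg hn G⁻
  obtain ⟨C, hC⟩ := CStarAlgebra.nonneg_iff_eq_star_mul_self.mp h2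
  refine ⟨G⁻, C, by rw [h1, hC], fun h0 => ?_⟩
  rw [h0, mul_zero] at hC
  have h3 : G⁻ = 0 := by
    have h4 : star (G⁻ * G⁻) * (G⁻ * G⁻) = 0 := by
      rw [star_mul, hs]
      rw [hs] at hC
      calc G⁻ * G⁻ * (G⁻ * G⁻) = (G⁻ * G⁻ * G⁻) * G⁻ := by simp only [mul_assoc]
        _ = 0 := by rw [hC, zero_mul]
    have h5 : star G⁻ * G⁻ = 0 := by
      rw [hs]; exact CStarRing.star_mul_self_eq_zero_iff _ |>.mp h4
    exact CStarRing.star_mul_self_eq_zero_iff _ |>.mp h5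
  have h6 : 0 ≤ G := (CFC.negPart_eq_zero_iff G hG).mp h3
  exact CStarAlgebra.nonneg_iff_eq_star_mul_self.mp h6

/-- The Gram matrix of a finite family in a Hilbert module is of the form `D⋆ D`. -/
theorem exists_gram {n : ℕ} (ξ : Fin n → E) :
    ∃ D : Fin n → Fin n → M, ∀ i j, ip M (ξ i) (ξ j) = ∑ k, star (D k i) * D k j := by
  let G : CStarMatrix (Fin n) (Fin n) M := CStarMatrix.ofMatrix fun i j => ip M (ξ i) (ξ j)
  have hGa : ∀ i j, G i j = ip M (ξ i) (ξ j) := fun i j => rfl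
  have hG : IsSelfAdjoint G := by
    ext i j
    rw [CStarMatrix.star_apply, hGa, hGa, star_ip]
  obtain ⟨N, C, h1, h2⟩ := exists_negPart G hG
  have hC : C = 0 := by
    ext k i
    have hd : (star N * G * N) i i
        = ip M (∑ k, MulOpposite.op (N k i) • ξ k) (∑ k, MulOpposite.op (N k i) • ξ k) := by
      simp only [CStarMatrix.mul_apply, CStarMatrix.star_apply, ip_sum_left, ip_sum_right,
        ip_rsmul_left, ip_rsmul_right, hGa, Finset.sum_mul, mul_assoc]
    have hc : (star C * C) i i = ∑ k, star (C k i) * C k i := by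
      simp only [CStarMatrix.mul_apply, CStarMatrix.star_apply]
    have h3 : 0 ≤ -∑ k, star (C k i) * C k i := by
      rw [← hc, ← CStarMatrix.neg_apply, ← h1, hd]
      exact ip_self_nonneg _
    have h4 : ∀ k ∈ Finset.univ, 0 ≤ star (C k i) * C k i := fun k _ => star_mul_self_nonneg _
    have h5 : ∑ k, star (C k i) * C k i = 0 :=
      le_antisymm (neg_nonneg.mp h3) (Finset.sum_nonneg h4)
    have h6 := (Finset.sum_eq_zero_iff_of_nonneg h4).mp h5 k (Finset.mem_univ k)
    simpa using (CStarRing.star_mul_self_eq_zero_iff _).mp h6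
  obtain ⟨D, hD⟩ := h2 hC
  refine ⟨fun i j => D i j, fun i j => ?_⟩
  rw [← hGa, hD]
  simp only [CStarMatrix.mul_apply, CStarMatrix.star_apply]

theorem gram_nonneg (R : Rep.{v, w} M) {n : ℕ} (ξ : Fin n → E) (h : Fin n → R.space) :
    0 ≤ ∑ i, ∑ j, ⟪h i, R.act (ip M (ξ i) (ξ j)) (h j)⟫_ℂ := by
  obtain ⟨D, hD⟩ := exists_gram (M := M) ξ
  have : ∑ i, ∑ j, ⟪h i, R.act (ip M (ξ i) (ξ j)) (h j)⟫_ℂ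
      = ∑ k, ⟪∑ i, R.act (D k i) (h i), ∑ j, R.act (D k j) (h j)⟫_ℂ := by
    simp only [hD, map_sum, map_mul, map_star, ContinuousLinearMap.star_eq_adjoint, sum_inner,
      inner_sum, sum_apply, _root_.mul_apply_eq_comp,
      ContinuousLinearMap.adjoint_inner_right]
    rw [Finset.sum_comm_cycle]
    exact Finset.sum_congr rfl fun k _ => Finset.sum_comm
  rw [this]
  refine Finset.sum_nonneg fun k _ => ?_
  rw [inner_self_eq_norm_sq_to_K]
  positivity

end Positivity


section Tensor

variable [PartialOrder M] {E : Type u}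
  [NormedAddCommGroup E] [NormedSpace ℂ E] [Module Mᵐᵒᵖ E] [HilbertModule M E]

/-- The sesquilinear form on `E ⊗ H` with `(ξ ⊗ h, ζ ⊗ k) ↦ ⟨h, σ(⟨ξ, ζ⟩) k⟩`. -/
def tensorForm (M : Type v) [CStarAlgebra M] [PartialOrder M] (E : Type u)
    [NormedAddCommGroup E] [NormedSpace ℂ E] [Module Mᵐᵒᵖ E] [HilbertModule M E]
    (R : Rep.{v, w} M) : (E ⊗[ℂ] R.space) →ₗ⋆[ℂ] (E ⊗[ℂ] R.space) →ₗ[ℂ] ℂ :=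
  TensorProduct.lift <|
    LinearMap.mk₂'ₛₗ (starRingEnd ℂ) (starRingEnd ℂ)
      (fun (ξ : E) (h : R.space) => TensorProduct.lift <|
        LinearMap.mk₂' ℂ ℂ (fun (ζ : E) (k : R.space) => ⟪h, R.act (ip M ξ ζ) k⟫_ℂ)
          (fun x y k => by simp [ip_add_right])
          (fun c x k => by simp [ip_smul_right])
          (fun x k l => by simp)
          (fun c x k => by simp))
      (fun x y h => by ext; simp [ip_add_left])
      (fun c x h => by ext; simp [ip_smul_left])
      (fun x h k => by ext; simp)
      (fun c x h => by ext; simp [mul_comm])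

@[simp]
theorem tensorForm_tmul (R : Rep.{v, w} M) (ξ ζ : E) (h k : R.space) :
    tensorForm M E R (ξ ⊗ₜ h) (ζ ⊗ₜ k) = ⟪h, R.act (ip M ξ ζ) k⟫_ℂ := rfl

theorem tensorForm_conj (R : Rep.{v, w} M) (x y : E ⊗[ℂ] R.space) :
    starRingEnd ℂ (tensorForm M E R y x) = tensorForm M E R x y := by
  induction x using TensorProduct.induction_on with
  | zero => simp
  | add x x' hx hx' => simp [hx, hx']
  | tmul ξ h =>
    induction y using TensorProduct.induction_on with
    | zero => simp
    | add y y' hy hy' => simp [hy, hy']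
    | tmul ζ k =>
      rw [tensorForm_tmul, tensorForm_tmul, inner_conj_symm, ← star_ip, map_star,
        ContinuousLinearMap.star_eq_adjoint, ContinuousLinearMap.adjoint_inner_left]

variable [StarOrderedRing M]

theorem tensorForm_nonneg (R : Rep.{v, w} M) (x : E ⊗[ℂ] R.space) :
    0 ≤ tensorForm M E R x x := by
  obtain ⟨n, ξ, h, rfl⟩ : ∃ (n : ℕ) (ξ : Fin n → E) (h : Fin n → R.space),
      x = ∑ i, ξ i ⊗ₜ[ℂ] h i := by
    induction x using TensorProduct.induction_on with
    | zero => exact ⟨0, Fin.elim0, Fin.elim0, by simp⟩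
    | tmul ξ h => exact ⟨1, fun _ => ξ, fun _ => h, by simp⟩
    | add x y hx hy =>
      obtain ⟨n, ξ, h, rfl⟩ := hx
      obtain ⟨m, ζ, k, rfl⟩ := hy
      exact ⟨n + m, Fin.append ξ ζ, Fin.append h k, by simp [Fin.sum_univ_add]⟩
  have := gram_nonneg R ξ h
  rw [Finset.sum_comm] at this
  simpa [sum_apply] using this

/-- The algebraic tensor product `E ⊗ H` with the semi-inner product given on simple tensors by
`⟨ξ ⊗ h, ζ ⊗ k⟩ = ⟨h, σ(⟨ξ, ζ⟩) k⟩`. -/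
def PreTensor (M : Type v) [CStarAlgebra M] [PartialOrder M] [StarOrderedRing M] (E : Type u)
    [NormedAddCommGroup E] [NormedSpace ℂ E] [Module Mᵐᵒᵖ E] [HilbertModule M E]
    (R : Rep.{v, w} M) : Type (max u w) := E ⊗[ℂ] R.space

namespace PreTensor

variable {R : Rep.{v, w} M}

instance : AddCommGroup (PreTensor M E R) := inferInstanceAs (AddCommGroup (E ⊗[ℂ] R.space))
instance : Module ℂ (PreTensor M E R) := inferInstanceAs (Module ℂ (E ⊗[ℂ] R.space))

variable (M E R) in
/-- The semi-inner product of `PreTensor`. -/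
abbrev core : PreInnerProductSpace.Core ℂ (PreTensor M E R) where
  inner x y := tensorForm M E R x y
  conj_inner_symm x y := tensorForm_conj R x y
  re_inner_nonneg x := (RCLike.nonneg_iff.mp (tensorForm_nonneg R x)).1
  add_left x y z := LinearMap.map_add₂ (tensorForm M E R) x y z
  smul_left x y c := LinearMap.map_smulₛₗ₂ (tensorForm M E R) c x y

instance : SeminormedAddCommGroup (PreTensor M E R) :=
  InnerProductSpace.Core.toSeminormedAddCommGroup (c := core M E R)
instance : InnerProductSpace ℂ (PreTensor M E R) := InnerProductSpace.ofCore (core M E R)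

variable (M) in
/-- The simple tensor. -/
def tmul (ξ : E) (h : R.space) : PreTensor M E R := ξ ⊗ₜ[ℂ] h

theorem inner_tmul (ξ ζ : E) (h k : R.space) :
    ⟪tmul M ξ h, tmul M ζ k⟫_ℂ = ⟪h, R.act (ip M ξ ζ) k⟫_ℂ := rfl

@[elab_as_elim]
theorem induction {p : PreTensor M E R → Prop} (x : PreTensor M E R) (zero : p 0)
    (tmul : ∀ ξ h, p (tmul M ξ h)) (add : ∀ x y, p x → p y → p (x + y)) : p x :=
  TensorProduct.induction_on x zero tmul add

end PreTensor

end Tensor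

end Representations

section Bound

theorem norm_pow_apply_le {V : Type*} [NormedAddCommGroup V] [NormedSpace ℂ V] (T : V →L[ℂ] V)
    (n : ℕ) (x : V) : ‖(T ^ n) x‖ ≤ ‖T‖ ^ n * ‖x‖ := by
  induction n with
  | zero => simp
  | succ n ih =>
    rw [pow_succ', pow_succ', mul_assoc]
    exact (ContinuousLinearMap.le_opNorm T _).trans
      (mul_le_mul_of_nonneg_left ih (norm_nonneg T))

/-- A linear map with a formal adjoint between semi-inner product spaces is bounded as soon as the
powers of `T⋆ T` grow at most geometrically on each vector. -/
theorem norm_le_of_formal_adjoint {V W : Type*} [SeminormedAddCommGroup V] [InnerProductSpace ℂ V]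
    [SeminormedAddCommGroup W] [InnerProductSpace ℂ W] (T : V →ₗ[ℂ] W) (S : W →ₗ[ℂ] V)
    (hTS : ∀ x y, ⟪T x, y⟫_ℂ = ⟪x, S y⟫_ℂ) (c : ℝ) (hc : 0 ≤ c)
    (hg : ∀ x, ∃ C : ℝ, ∀ n : ℕ, ‖(S ∘ₗ T)^[n] x‖ ≤ C * c ^ n) (x : V) :
    ‖T x‖ ≤ √c * ‖x‖ := by
  set A : V → V := ⇑(S ∘ₗ T) with hA
  have hsym : ∀ y z, ⟪A y, z⟫_ℂ = ⟪y, A z⟫_ℂ := fun y z => by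
    change ⟪S (T y), z⟫_ℂ = ⟪y, S (T z)⟫_ℂ
    rw [← hTS, ← inner_conj_symm, ← hTS, inner_conj_symm]
  have hT : ‖T x‖ ^ 2 ≤ ‖x‖ * ‖A x‖ := by
    have h1 : ⟪T x, T x⟫_ℂ = ⟪x, A x⟫_ℂ := hTS _ _
    have h2 := norm_inner_le_norm (𝕜 := ℂ) x (A x)
    rw [← h1, inner_self_eq_norm_sq_to_K] at h2
    simpa using h2
  set a : ℕ → ℝ := fun n => ‖A^[n] x‖ with ha
  have hlog : ∀ n, a (n + 1) ^ 2 ≤ a n * a (n + 2) := fun n => by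
    have h1 : ⟪A^[n + 1] x, A^[n + 1] x⟫_ℂ = ⟪A^[n] x, A^[n + 2] x⟫_ℂ := by
      rw [Function.iterate_succ_apply' A n x, Function.iterate_succ_apply' A (n + 1) x,
        Function.iterate_succ_apply' A n x, hsym]
    have h2 := norm_inner_le_norm (𝕜 := ℂ) (A^[n] x) (A^[n + 2] x)
    rw [← h1, inner_self_eq_norm_sq_to_K] at h2
    rw [norm_pow, RCLike.norm_ofReal, abs_norm] at h2
    exact h2
  suffices h : ‖T x‖ ^ 2 ≤ c * ‖x‖ ^ 2 by
    have := Real.sqrt_le_sqrt h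
    rwa [Real.sqrt_sq (norm_nonneg _), Real.sqrt_mul hc, Real.sqrt_sq (norm_nonneg _)] at this
  by_contra hcon
  push Not at hcon
  have ha0 : 0 < a 0 := by
    rcases (norm_nonneg x).eq_or_lt with h | h
    · rw [← h] at hcon hT
      simp at hcon hT
      rw [hT] at hcon
      simp at hcon
    · exact h
  have h10 : c * a 0 < a 1 := by
    have h1 : c * ‖x‖ ^ 2 < ‖x‖ * ‖A x‖ := hcon.trans_le hT
    have h2 : c * a 0 * a 0 < a 1 * a 0 := by
      change c * ‖x‖ * ‖x‖ < ‖A x‖ * ‖x‖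
      nlinarith
    exact lt_of_mul_lt_mul_right h2 ha0.le
  have hr : c < a 1 / a 0 := by rwa [lt_div_iff₀ ha0]
  set r := a 1 / a 0 with hrdef
  have hrpos : 0 < r := hc.trans_lt hr
  have hstep : ∀ n, 0 < a n ∧ r * a n ≤ a (n + 1) := by
    intro n
    induction n with
    | zero => exact ⟨ha0, by rw [hrdef, div_mul_cancel₀ _ ha0.ne']⟩
    | succ n ih =>
      obtain ⟨h1, h2⟩ := ih
      have h3 : 0 < a (n + 1) := (mul_pos hrpos h1).trans_le h2
      refine ⟨h3, ?_⟩
      have h4 := hlog n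
      have h5 : r * a (n + 1) * a n ≤ a (n + 2) * a n := by nlinarith
      exact le_of_mul_le_mul_right h5 h1
  have hgeo : ∀ n, a 0 * r ^ n ≤ a n := by
    intro n
    induction n with
    | zero => simp
    | succ n ih =>
      calc a 0 * r ^ (n + 1) = r * (a 0 * r ^ n) := by ring
        _ ≤ r * a n := by gcongr
        _ ≤ a (n + 1) := (hstep n).2
  obtain ⟨C, hC⟩ := hg x
  have hle : ∀ n : ℕ, a 0 ≤ C * (c / r) ^ n := fun n => by
    have h1 := (hgeo n).trans (hC n)
    rw [div_pow, mul_div_assoc', le_div_iff₀ (pow_pos hrpos n)]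
    exact h1
  have hlim : Filter.Tendsto (fun n : ℕ => C * (c / r) ^ n) Filter.atTop (nhds (C * 0)) :=
    (tendsto_pow_atTop_nhds_zero_of_lt_one (by positivity) (by rwa [div_lt_one hrpos])).const_mul C
  have := ge_of_tendsto' hlim hle
  simp at this
  linarith

end Bound

section TensorMaps

variable {M : Type v} [CStarAlgebra M] [PartialOrder M] [StarOrderedRing M] {E : Type u}
  [NormedAddCommGroup E] [NormedSpace ℂ E] [Module Mᵐᵒᵖ E] [HilbertModule M E]
  {R : Rep.{v, w} M} {R' : Rep.{v, w'} M}

namespace PreTensor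

theorem norm_tmul_le (ξ : E) (h : R.space) : ‖tmul M (R := R) ξ h‖ ≤ ‖ξ‖ * ‖h‖ := by
  rw [← sq_le_sq₀ (norm_nonneg _) (by positivity), mul_pow, norm_sq_eq (M := M)]
  have h1 : ‖tmul M (R := R) ξ h‖ ^ 2 = ‖⟪h, R.act (ip M ξ ξ) h⟫_ℂ‖ := by
    rw [← inner_tmul, inner_self_eq_norm_sq_to_K]
    simp
  rw [h1]
  calc _ ≤ ‖h‖ * (‖R.act (ip M ξ ξ)‖ * ‖h‖) :=
        (norm_inner_le_norm _ _).trans (by gcongr; exact ContinuousLinearMap.le_opNorm _ _)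
    _ ≤ ‖h‖ * (‖ip M ξ ξ‖ * ‖h‖) := by gcongr; exact NonUnitalStarAlgHom.norm_apply_le _ _
    _ = _ := by ring

/-- `X ⊗ S` on the algebraic tensor product. -/
def map (X : Adjointable M E) (S : Intertwiner R R') : PreTensor M E R →ₗ[ℂ] PreTensor M E R' :=
  TensorProduct.map X.1.toLinearMap S.1.toLinearMap

@[simp]
theorem map_tmul (X : Adjointable M E) (S : Intertwiner R R') (ξ : E) (h : R.space) :
    map X S (tmul M ξ h) = tmul M (X.1 ξ) (S.1 h) := rfl

theorem inner_map (X : Adjointable M E) (S : Intertwiner R R') (x : PreTensor M E R)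
    (y : PreTensor M E R') : ⟪map X S x, y⟫_ℂ = ⟪x, map (star X) (Intertwiner.adj S) y⟫_ℂ := by
  induction x using PreTensor.induction with
  | zero => simp
  | add x x' hx hx' => rw [map_add, inner_add_left, inner_add_left, hx, hx']
  | tmul ξ h =>
    induction y using PreTensor.induction with
    | zero => simp
    | add y y' hy hy' => rw [map_add, inner_add_right, inner_add_right, hy, hy']
    | tmul ζ k =>
      rw [map_tmul, map_tmul, inner_tmul, inner_tmul, Adjointable.ip_left,
        ← Intertwiner.apply (Intertwiner.adj S)]
      exact (ContinuousLinearMap.adjoint_inner_right _ _ _).symm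

theorem norm_map_le (X : Adjointable M E) (S : Intertwiner R R') (x : PreTensor M E R) :
    ‖map X S x‖ ≤ √(‖(star X).1 ∘L X.1‖ * ‖(Intertwiner.adj S).1 ∘L S.1‖) * ‖x‖ := by
  refine norm_le_of_formal_adjoint (map X S) (map (star X) (Intertwiner.adj S)) (inner_map X S) _
    (by positivity) (fun x => ?_) x
  induction x using PreTensor.induction with
  | zero =>
    refine ⟨0, fun n => ?_⟩
    rw [Function.iterate_fixed (map_zero _)]
    simp
  | add x y hx hy =>
    obtain ⟨C, hC⟩ := hx
    obtain ⟨D, hD⟩ := hy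
    refine ⟨C + D, fun n => ?_⟩
    rw [← Module.End.coe_pow, map_add, add_mul, Module.End.coe_pow]
    exact (norm_add_le _ _).trans (add_le_add (hC n) (hD n))
  | tmul ξ h =>
    refine ⟨‖ξ‖ * ‖h‖, fun n => ?_⟩
    have key : (⇑(map (star X) (Intertwiner.adj S) ∘ₗ map X S))^[n] (tmul M ξ h)
        = tmul M ((((star X).1 ∘L X.1) ^ n) ξ) ((((Intertwiner.adj S).1 ∘L S.1) ^ n) h) := by
      induction n with
      | zero => rfl
      | succ n ih =>
        rw [Function.iterate_succ_apply', ih, pow_succ', pow_succ']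
        rfl
    rw [key]
    refine (norm_tmul_le _ _).trans ?_
    have h1 := norm_pow_apply_le ((star X).1 ∘L X.1) n ξ
    have h2 := norm_pow_apply_le ((Intertwiner.adj S).1 ∘L S.1) n h
    calc _ ≤ (‖(star X).1 ∘L X.1‖ ^ n * ‖ξ‖) * (‖(Intertwiner.adj S).1 ∘L S.1‖ ^ n * ‖h‖) := by gcongr
      _ = _ := by rw [mul_pow]; ring

end PreTensor

variable (M E R) in
/-- The Hilbert space `E ⊗_σ H` (`R = (H, σ)`): the Hausdorff completion of the algebraic tensor
product `E ⊗ H` for the semi-inner product `⟨ξ ⊗ h, ζ ⊗ k⟩ = ⟨h, σ(⟨ξ, ζ⟩) k⟩`. -/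
abbrev Tensor : Type (max u w) := UniformSpace.Completion (PreTensor M E R)

namespace Tensor

/-- The operator `h ↦ ξ ⊗ h` from `H` to `E ⊗_σ H`. -/
def tmul (M : Type v) [CStarAlgebra M] [PartialOrder M] [StarOrderedRing M] {E : Type u}
    [NormedAddCommGroup E] [NormedSpace ℂ E] [Module Mᵐᵒᵖ E] [HilbertModule M E]
    {R : Rep.{v, w} M} (ξ : E) : R.space →L[ℂ] Tensor M E R :=
  UniformSpace.Completion.toComplL ∘L
    LinearMap.mkContinuous (TensorProduct.mk ℂ E R.space ξ : R.space →ₗ[ℂ] PreTensor M E R) ‖ξ‖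
      fun h => PreTensor.norm_tmul_le ξ h

theorem tmul_apply (ξ : E) (h : R.space) :
    tmul M ξ h = ((PreTensor.tmul M ξ h : PreTensor M E R) : Tensor M E R) := rfl

theorem inner_tmul (ξ ζ : E) (h k : R.space) :
    ⟪tmul M ξ h, tmul M ζ k⟫_ℂ = ⟪h, R.act (ip M ξ ζ) k⟫_ℂ := by
  rw [tmul_apply, tmul_apply, UniformSpace.Completion.inner_coe, PreTensor.inner_tmul]

/-- Two continuous maps which agree on simple tensors and are additive are equal. -/
theorem ext {V : Type*} [NormedAddCommGroup V] [NormedSpace ℂ V] {T T' : Tensor M E R →L[ℂ] V}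
    (h : ∀ ξ k, T (tmul M ξ k) = T' (tmul M ξ k)) : T = T' := by
  ext x
  induction x using UniformSpace.Completion.induction_on with
  | hp => exact isClosed_eq T.continuous T'.continuous
  | ih x =>
    induction x using PreTensor.induction with
    | zero => rw [UniformSpace.Completion.coe_zero, map_zero, map_zero]
    | add x y hx hy => rw [UniformSpace.Completion.coe_add, map_add, map_add, hx, hy]
    | tmul ξ k => exact h ξ k

theorem ext_inner {x y : Tensor M E R} (h : ∀ ξ k, ⟪tmul M ξ k, x⟫_ℂ = ⟪tmul M ξ k, y⟫_ℂ) :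
    x = y := by
  have : innerSL ℂ x = innerSL ℂ y := ext fun ξ k => by
    rw [innerSL_apply_apply, innerSL_apply_apply, ← inner_conj_symm, h, inner_conj_symm]
  exact innerSL_inj.mp this

/-- The bounded operator `X ⊗ S : E ⊗_σ H → E ⊗_σ' H'`, for `X ∈ 𝓛(E)` and an operator
`S : H → H'` intertwining `σ` and `σ'`; `(X ⊗ S)(ξ ⊗ h) = X ξ ⊗ S h`. -/
def map (X : Adjointable M E) (S : Intertwiner R R') : Tensor M E R →L[ℂ] Tensor M E R' :=
  ((PreTensor.map X S).mkContinuous _ (PreTensor.norm_map_le X S)).completion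

@[simp]
theorem map_tmul (X : Adjointable M E) (S : Intertwiner R R') (ξ : E) (h : R.space) :
    map X S (tmul M ξ h) = tmul M (X.1 ξ) (S.1 h) := by
  rw [tmul_apply, map, ContinuousLinearMap.completion_apply_coe]
  rfl

theorem norm_map_le (X : Adjointable M E) (S : Intertwiner R R') :
    ‖map X S‖ ≤ √(‖(star X).1 ∘L X.1‖ * ‖(Intertwiner.adj S).1 ∘L S.1‖) := by
  refine ContinuousLinearMap.opNorm_le_bound _ (by positivity) fun x => ?_
  induction x using UniformSpace.Completion.induction_on with
  | hp => exact isClosed_le (by fun_prop) (by fun_prop)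
  | ih x =>
    rw [map, ContinuousLinearMap.completion_apply_coe, UniformSpace.Completion.norm_coe,
      UniformSpace.Completion.norm_coe]
    exact PreTensor.norm_map_le X S x

theorem adjoint_map (X : Adjointable M E) (S : Intertwiner R R') :
    ContinuousLinearMap.adjoint (map X S) = map (star X) (Intertwiner.adj S) := by
  refine ext fun ζ k => ext_inner fun ξ h => ?_
  rw [ContinuousLinearMap.adjoint_inner_right, map_tmul, map_tmul, inner_tmul, inner_tmul,
    Adjointable.ip_left, ← Intertwiner.apply (Intertwiner.adj S)]
  exact (ContinuousLinearMap.adjoint_inner_right _ _ _).symm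

variable (R) in
/-- The representation `X ↦ X ⊗ I_H` of `𝓛(E)` on `E ⊗_σ H`. -/
def amp : Adjointable M E →⋆ₙₐ[ℂ] (Tensor M E R →L[ℂ] Tensor M E R) where
  toFun X := map X (Intertwiner.id R)
  map_smul' c X := ext fun ξ h => by
    rw [smul_apply, map_tmul, map_tmul]
    change tmul M (c • X.1 ξ) h = c • tmul M (X.1 ξ) h
    refine ext_inner fun ζ k => ?_
    rw [inner_tmul, inner_smul_right, inner_tmul, ip_smul_right, map_smul, smul_apply,
      inner_smul_right]
  map_zero' := ext fun ξ h => by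
    rw [map_tmul]
    change tmul M (0 : E) h = 0
    refine ext_inner fun ζ k => ?_
    rw [inner_tmul, ip_zero_right]
    simp
  map_add' X Y := ext fun ξ h => by
    rw [add_apply, map_tmul, map_tmul, map_tmul]
    change tmul M (X.1 ξ + Y.1 ξ) h = tmul M (X.1 ξ) h + tmul M (Y.1 ξ) h
    refine ext_inner fun ζ k => ?_
    rw [inner_add_right, inner_tmul, inner_tmul, inner_tmul, ip_add_right, map_add, add_apply,
      inner_add_right]
  map_mul' X Y := ext fun ξ h => by
    change _ = map X _ (map Y _ (tmul M ξ h))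
    rw [map_tmul, map_tmul, map_tmul]
    rfl
  map_star' X := by
    rw [ContinuousLinearMap.star_eq_adjoint, adjoint_map]
    congr 1
    apply Subtype.ext
    exact (ContinuousLinearMap.adjoint_id (𝕜 := ℂ) (E := R.space)).symm

end Tensor

/-- The Hilbert space `E ⊗_σ H` with the induced representation `a ↦ φ(a) ⊗ I_H` of `M`. -/
def Rep.induced (φ : M →⋆ₙₐ[ℂ] Adjointable M E) (R : Rep.{v, w} M) : Rep.{v, max u w} M where
  space := Tensor M E R
  act := (Tensor.amp R).comp φ

/-- `I_E ⊗ S : E ⊗_σ H → E ⊗_σ' H'` as an intertwiner of the induced representations. -/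
def Intertwiner.induced (φ : M →⋆ₙₐ[ℂ] Adjointable M E) (S : Intertwiner R R') :
    Intertwiner (R.induced φ) (R'.induced φ) :=
  ⟨Tensor.map 1 S, fun a => Tensor.ext fun ξ h => by
    change Tensor.map 1 S (Tensor.map (φ a) _ (Tensor.tmul M ξ h))
      = Tensor.map (φ a) _ (Tensor.map 1 S (Tensor.tmul M ξ h))
    simp only [Tensor.map_tmul]
    rfl⟩

end TensorMaps

section HilbertSum

/-- A sequence of maps into Hilbert spaces, square-summably bounded, gives an operator into the
Hilbert sum. -/
def lpBuild {V : Type*} [NormedAddCommGroup V] [NormedSpace ℂ V] {G : ℕ → Type*}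
    [∀ n, NormedAddCommGroup (G n)] [∀ n, InnerProductSpace ℂ (G n)] (A : ∀ n, V →ₗ[ℂ] G n)
    (c : ℝ) (hc : 0 ≤ c) (hA : ∀ f, ∀ s : Finset ℕ, ∑ n ∈ s, ‖A n f‖ ^ 2 ≤ c ^ 2 * ‖f‖ ^ 2) :
    V →L[ℂ] lp G 2 :=
  LinearMap.mkContinuous
    { toFun := fun f => ⟨fun n => A n f, memℓp_gen' (C := c ^ 2 * ‖f‖ ^ 2) fun s => by
        simpa using hA f s⟩
      map_add' := fun f g => lp.ext (funext fun n => map_add (A n) f g)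
      map_smul' := fun a f => lp.ext (funext fun n => map_smul (A n) a f) } c
    fun f => lp.norm_le_of_forall_sum_le (by simp) (by positivity) fun s => by
      simpa [mul_pow] using hA f s

@[simp]
theorem lpBuild_apply {V : Type*} [NormedAddCommGroup V] [NormedSpace ℂ V] {G : ℕ → Type*}
    [∀ n, NormedAddCommGroup (G n)] [∀ n, InnerProductSpace ℂ (G n)] (A : ∀ n, V →ₗ[ℂ] G n)
    (c : ℝ) (hc : 0 ≤ c) (hA : ∀ f, ∀ s : Finset ℕ, ∑ n ∈ s, ‖A n f‖ ^ 2 ≤ c ^ 2 * ‖f‖ ^ 2)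
    (f : V) (n : ℕ) : lpBuild A c hc hA f n = A n f := rfl

theorem lp_sum_sq_le {G : ℕ → Type*} [∀ n, NormedAddCommGroup (G n)] (f : lp G 2)
    (s : Finset ℕ) : ∑ n ∈ s, ‖f n‖ ^ 2 ≤ ‖f‖ ^ 2 := by
  simpa using lp.sum_rpow_le_norm_rpow (p := 2) (by simp) f s

/-- The diagonal operator between Hilbert sums. -/
def lpDiag {G G' : ℕ → Type*} [∀ n, NormedAddCommGroup (G n)] [∀ n, InnerProductSpace ℂ (G n)]
    [∀ n, NormedAddCommGroup (G' n)] [∀ n, InnerProductSpace ℂ (G' n)] (A : ∀ n, G n →L[ℂ] G' n)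
    (c : ℝ) (hc : 0 ≤ c) (hA : ∀ n, ‖A n‖ ≤ c) : lp G 2 →L[ℂ] lp G' 2 :=
  lpBuild (fun n => (A n).toLinearMap ∘ₗ LinearMap.proj n ∘ₗ (lpSubmodule ℂ G 2).subtype) c hc
    fun f s => by
      calc _ ≤ ∑ n ∈ s, c ^ 2 * ‖f n‖ ^ 2 := by
            refine Finset.sum_le_sum fun n _ => ?_
            rw [← mul_pow]
            refine pow_le_pow_left₀ (norm_nonneg _) ?_ 2
            exact ((A n).le_opNorm (f n)).trans (mul_le_mul_of_nonneg_right (hA n) (norm_nonneg _))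
        _ ≤ _ := by
            rw [← Finset.mul_sum]
            gcongr
            exact lp_sum_sq_le f s

@[simp]
theorem lpDiag_apply {G G' : ℕ → Type*} [∀ n, NormedAddCommGroup (G n)]
    [∀ n, InnerProductSpace ℂ (G n)] [∀ n, NormedAddCommGroup (G' n)]
    [∀ n, InnerProductSpace ℂ (G' n)] (A : ∀ n, G n →L[ℂ] G' n) (c : ℝ) (hc : 0 ≤ c)
    (hA : ∀ n, ‖A n‖ ≤ c) (f : lp G 2) (n : ℕ) : lpDiag A c hc hA f n = A n (f n) := rfl

end HilbertSum

section FockHilbert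

variable {M : Type v} [CStarAlgebra M] [PartialOrder M] [StarOrderedRing M] {E : Type u}
  [NormedAddCommGroup E] [NormedSpace ℂ E] [Module Mᵐᵒᵖ E] [HilbertModule M E]
  (φ : M →⋆ₙₐ[ℂ] Adjointable M E)

/-- The Hilbert space `E^{⊗ n} ⊗_σ H = E ⊗ (E ⊗ ⋯ (E ⊗_σ H))` with the left action
`φ_n(·) ⊗ I_H` of `M`; for `n = 0` it is `(H, σ)`. -/
def level (R : Rep.{v, u} M) : ℕ → Rep.{v, u} M
  | 0 => R
  | n + 1 => (level R n).induced φ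

/-- The operator `I_{E^{⊗ n}} ⊗ S`. -/
def levelMap {R R' : Rep.{v, u} M} (S : Intertwiner R R') :
    ∀ n, Intertwiner (level φ R n) (level φ R' n)
  | 0 => S
  | n + 1 => Intertwiner.induced φ (levelMap S n)

theorem Tensor.norm_map_one_le {R : Rep.{v, w} M} {R' : Rep.{v, w'} M} (S : Intertwiner R R') :
    ‖Tensor.map (1 : Adjointable M E) S‖ ≤ ‖S.1‖ := by
  refine (Tensor.norm_map_le _ _).trans ?_
  rw [Adjointable.star_one, Real.sqrt_le_iff]
  refine ⟨norm_nonneg _, ?_⟩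
  have h1 : ‖(1 : Adjointable M E).1 ∘L (1 : Adjointable M E).1‖ ≤ 1 :=
    ContinuousLinearMap.norm_id_le
  have h2 : ‖(Intertwiner.adj S).1 ∘L S.1‖ ≤ ‖S.1‖ * ‖S.1‖ := by
    refine (ContinuousLinearMap.opNorm_comp_le _ _).trans ?_
    rw [Intertwiner.adj, LinearIsometryEquiv.norm_map]
  calc _ ≤ 1 * (‖S.1‖ * ‖S.1‖) := by gcongr
    _ = _ := by ring

theorem norm_levelMap_le {R R' : Rep.{v, u} M} (S : Intertwiner R R') (n : ℕ) :
    ‖(levelMap φ S n).1‖ ≤ ‖S.1‖ := by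
  induction n with
  | zero => exact le_rfl
  | succ n ih => exact (Tensor.norm_map_one_le _).trans ih

theorem levelMap_adj {R R' : Rep.{v, u} M} (S : Intertwiner R R') (n : ℕ) :
    levelMap φ (Intertwiner.adj S) n = Intertwiner.adj (levelMap φ S n) := by
  induction n with
  | zero => rfl
  | succ n ih =>
    apply Subtype.ext
    change Tensor.map 1 (levelMap φ (Intertwiner.adj S) n)
      = ContinuousLinearMap.adjoint (Tensor.map 1 (levelMap φ S n))
    rw [Tensor.adjoint_map, ih, Adjointable.star_one]

/-- The Hilbert space `⊕ₙ E^{⊗ n} ⊗_σ H`. -/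
abbrev FockSum (R : Rep.{v, u} M) : Type u := lp (fun n => (level φ R n).space) 2

/-- `diag(I_{E^{⊗ n}} ⊗ S)`. -/
def fockMap {R R' : Rep.{v, u} M} (S : Intertwiner R R') : FockSum φ R →L[ℂ] FockSum φ R' :=
  lpDiag (fun n => (levelMap φ S n).1) ‖S.1‖ (norm_nonneg _) (norm_levelMap_le φ S)

theorem fockMap_adj {R R' : Rep.{v, u} M} (S : Intertwiner R R') :
    fockMap φ (Intertwiner.adj S) = ContinuousLinearMap.adjoint (fockMap φ S) := by
  refine (ContinuousLinearMap.eq_adjoint_iff _ _).mpr fun f g => ?_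
  rw [lp.inner_eq_tsum, lp.inner_eq_tsum]
  refine tsum_congr fun n => ?_
  rw [fockMap, fockMap, lpDiag_apply, lpDiag_apply, levelMap_adj]
  exact ContinuousLinearMap.adjoint_inner_left _ _ _

/-- The left action `a ↦ diag(φ₀(a), φ₁(a), …) ⊗ I_H` of `M`. -/
def fockAct (R : Rep.{v, u} M) : M →⋆ₙₐ[ℂ] (FockSum φ R →L[ℂ] FockSum φ R) where
  toFun a := lpDiag (fun n => (level φ R n).act a) ‖a‖ (norm_nonneg a) fun n =>
    NonUnitalStarAlgHom.norm_apply_le _ _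
  map_smul' c a := by ext f n; simp
  map_zero' := by ext f n; simp
  map_add' a b := by ext f n; simp
  map_mul' a b := by ext f n; simp
  map_star' a := by
    rw [ContinuousLinearMap.star_eq_adjoint]
    refine (ContinuousLinearMap.eq_adjoint_iff _ _).mpr fun f g => ?_
    rw [lp.inner_eq_tsum, lp.inner_eq_tsum]
    refine tsum_congr fun n => ?_
    rw [lpDiag_apply, lpDiag_apply, map_star, ContinuousLinearMap.star_eq_adjoint,
      ContinuousLinearMap.adjoint_inner_left]

theorem fockAct_apply (R : Rep.{v, u} M) (a : M) (f : FockSum φ R) (n : ℕ) :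
    fockAct φ R a f n = (level φ R n).act a (f n) := rfl

theorem fockMap_act {R R' : Rep.{v, u} M} (S : Intertwiner R R') (a : M) :
    fockAct φ R' a ∘L fockMap φ S = fockMap φ S ∘L fockAct φ R a := by
  ext f n
  exact (Intertwiner.apply (levelMap φ S n) a (f n)).symm

/-- The components of the operator `y ↦ ξ ⊗ y`. -/
def shiftAux (R : Rep.{v, u} M) (ξ : E) : ∀ n, FockSum φ R →ₗ[ℂ] (level φ R n).space
  | 0 => 0
  | n + 1 => (Tensor.tmul M (R := level φ R n) ξ).toLinearMap ∘ₗ LinearMap.proj n ∘ₗ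
      (lpSubmodule ℂ (fun n => (level φ R n).space) 2).subtype

/-- The operator `y ↦ ξ ⊗ y` on `⊕ₙ E^{⊗ n} ⊗_σ H`, mapping the `n`-th summand to the
`(n + 1)`-st one. -/
def shift (R : Rep.{v, u} M) (ξ : E) : FockSum φ R →L[ℂ] FockSum φ R :=
  lpBuild (shiftAux φ R ξ) ‖ξ‖ (norm_nonneg _) fun f s => by
    have h1 : ∀ n, ‖shiftAux φ R ξ (n + 1) f‖ ^ 2 ≤ ‖ξ‖ ^ 2 * ‖f n‖ ^ 2 := fun n => by
      rw [← mul_pow]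
      refine pow_le_pow_left₀ (norm_nonneg _) ?_ 2
      exact (UniformSpace.Completion.norm_coe _).trans_le (PreTensor.norm_tmul_le ξ (f n))
    obtain ⟨m, hm⟩ := s.exists_nat_subset_range
    calc ∑ n ∈ s, ‖shiftAux φ R ξ n f‖ ^ 2
        ≤ ∑ n ∈ Finset.range (m + 1), ‖shiftAux φ R ξ n f‖ ^ 2 :=
          Finset.sum_le_sum_of_subset_of_nonneg
            (hm.trans (Finset.range_subset_range.mpr m.le_succ)) fun _ _ _ => by positivity
      _ = ∑ n ∈ Finset.range m, ‖shiftAux φ R ξ (n + 1) f‖ ^ 2 := by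
          rw [Finset.sum_range_succ']
          simp [shiftAux]
      _ ≤ ∑ n ∈ Finset.range m, ‖ξ‖ ^ 2 * ‖f n‖ ^ 2 := Finset.sum_le_sum fun n _ => h1 n
      _ ≤ _ := by
          rw [← Finset.mul_sum]
          gcongr
          exact lp_sum_sq_le f _

theorem shift_zero (R : Rep.{v, u} M) (ξ : E) (f : FockSum φ R) : shift φ R ξ f 0 = 0 := rfl

theorem shift_succ (R : Rep.{v, u} M) (ξ : E) (f : FockSum φ R) (n : ℕ) :
    shift φ R ξ f (n + 1) = Tensor.tmul M (R := level φ R n) ξ (f n) := rfl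

theorem shift_fockMap {R R' : Rep.{v, u} M} (S : Intertwiner R R') (ξ : E) :
    shift φ R' ξ ∘L fockMap φ S = fockMap φ S ∘L shift φ R ξ := by
  ext f n
  cases n with
  | zero => exact (map_zero (levelMap φ S 0).1).symm
  | succ n => exact (Tensor.map_tmul 1 (levelMap φ S n) ξ (f n)).symm

theorem inner_shift_succ (R : Rep.{v, u} M) (ξ ζ : E) (x y : FockSum φ R) (n : ℕ) :
    ⟪shift φ R ξ x (n + 1), shift φ R ζ y (n + 1)⟫_ℂ
      = ⟪x n, fockAct φ R (ip M ξ ζ) y n⟫_ℂ := by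
  rw [shift_succ, shift_succ, fockAct_apply]
  exact Tensor.inner_tmul (R := level φ R n) ξ ζ (x n) (y n)

theorem inner_shift (R : Rep.{v, u} M) (ξ ζ : E) (x y : FockSum φ R) :
    ⟪shift φ R ξ x, shift φ R ζ y⟫_ℂ = ⟪x, fockAct φ R (ip M ξ ζ) y⟫_ℂ := by
  have h := lp.summable_inner (𝕜 := ℂ) (shift φ R ξ x) (shift φ R ζ y)
  have h0 : ⟪shift φ R ξ x 0, shift φ R ζ y 0⟫_ℂ = 0 := by
    rw [shift_zero]
    exact inner_zero_left _
  rw [lp.inner_eq_tsum, lp.inner_eq_tsum, h.tsum_eq_zero_add, h0, zero_add]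
  exact tsum_congr (inner_shift_succ φ R ξ ζ x y)

theorem adjoint_shift_comp (R : Rep.{v, u} M) (ξ ζ : E) :
    ContinuousLinearMap.adjoint (shift φ R ξ) ∘L shift φ R ζ = fockAct φ R (ip M ξ ζ) := by
  ext1 y
  refine ext_inner_left ℂ fun x => ?_
  rw [ContinuousLinearMap.comp_apply, ContinuousLinearMap.adjoint_inner_right]
  exact inner_shift φ R ξ ζ x y

/-- The inclusion of the zeroth summand. -/
def zeroth (R : Rep.{v, u} M) : R.space →L[ℂ] FockSum φ R :=
  lp.singleContinuousLinearMap ℂ (fun n => (level φ R n).space) 2 0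

theorem zeroth_act (R : Rep.{v, u} M) (a : M) :
    zeroth φ R ∘L R.act a = fockAct φ R a ∘L zeroth φ R := by
  ext k n
  cases n with
  | zero => rfl
  | succ n => exact (map_zero ((level φ R (n + 1)).act a)).symm

theorem zeroth_fockMap {R R' : Rep.{v, u} M} (S : Intertwiner R R') :
    zeroth φ R' ∘L S.1 = fockMap φ S ∘L zeroth φ R := by
  ext k n
  cases n with
  | zero => rfl
  | succ n => exact (map_zero (levelMap φ S (n + 1)).1).symm

/-- The Hilbert space `⊕ₙ E^{⊗ n} ⊗_σ H` with the left action
`a ↦ diag(φ₀(a), φ₁(a), …) ⊗ I_H` of `M`. -/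
def Rep.fock (R : Rep.{v, u} M) : Rep.{v, u} M where
  space := FockSum φ R
  act := fockAct φ R

/-- The operator `diag(I_{E^{⊗ n}} ⊗ S)` on `⊕ₙ E^{⊗ n} ⊗_σ H`. -/
def Intertwiner.fock {R R' : Rep.{v, u} M} (S : Intertwiner R R') :
    Intertwiner (R.fock φ) (R'.fock φ) :=
  ⟨fockMap φ S, fun a => (fockMap_act φ S a).symm⟩

theorem Intertwiner.fock_adj {R R' : Rep.{v, u} M} (S : Intertwiner R R') :
    (Intertwiner.fock φ (Intertwiner.adj S)).1
      = ContinuousLinearMap.adjoint (Intertwiner.fock φ S).1 := fockMap_adj φ S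

/-- The operator `y ↦ ξ ⊗ y` on `⊕ₙ E^{⊗ n} ⊗_σ H`. -/
def Rep.shift (R : Rep.{v, u} M) (ξ : E) : (R.fock φ).space →L[ℂ] (R.fock φ).space :=
  HardyPoisson.shift φ R ξ

theorem Rep.shift_fock {R R' : Rep.{v, u} M} (S : Intertwiner R R') (ξ : E) :
    R'.shift φ ξ ∘L (Intertwiner.fock φ S).1 = (Intertwiner.fock φ S).1 ∘L R.shift φ ξ :=
  shift_fockMap φ S ξ

/-- `⟨ξ ⊗ x, ζ ⊗ y⟩ = ⟨x, ⟨ξ, ζ⟩ y⟩`. -/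
theorem Rep.adjoint_shift_comp (R : Rep.{v, u} M) (ξ ζ : E) :
    ContinuousLinearMap.adjoint (R.shift φ ξ) ∘L R.shift φ ζ = (R.fock φ).act (ip M ξ ζ) :=
  HardyPoisson.adjoint_shift_comp φ R ξ ζ

/-- The operator `h ↦ 1_M ⊗ h` onto the zeroth summand of `⊕ₙ E^{⊗ n} ⊗_σ H`. -/
def Intertwiner.zeroth (R : Rep.{v, u} M) : Intertwiner R (R.fock φ) :=
  ⟨HardyPoisson.zeroth φ R, zeroth_act φ R⟩

theorem Intertwiner.zeroth_fock {R R' : Rep.{v, u} M} (S : Intertwiner R R') :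
    (Intertwiner.zeroth φ R').1 ∘L S.1 = (Intertwiner.fock φ S).1 ∘L (Intertwiner.zeroth φ R).1 :=
  zeroth_fockMap φ S

end FockHilbert

section FockModule

variable {M : Type v} [CStarAlgebra M] {K : Type u} [NormedAddCommGroup K]
  [InnerProductSpace ℂ K] [CompleteSpace K]

/-- The representation of `M` on `K` given by an isomorphism of `M` onto a von Neumann algebra on
`K`. -/
def Rep.ofVN {N : VonNeumannAlgebra K} (π : M ≃⋆ₐ[ℂ] N.toStarSubalgebra) : Rep.{v, u} M where
  space := K
  act :=
    { toFun := fun a => (π a : K →L[ℂ] K)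
      map_smul' := fun c a => by rw [map_smul]; rfl
      map_zero' := by rw [map_zero]; rfl
      map_add' := fun a b => by rw [map_add]; rfl
      map_mul' := fun a b => by rw [map_mul]; rfl
      map_star' := fun a => by rw [map_star]; rfl }

variable {N : VonNeumannAlgebra K} (π : M ≃⋆ₐ[ℂ] N.toStarSubalgebra)

theorem Rep.ofVN_act (a : M) : (Rep.ofVN π).act a = (π a : K →L[ℂ] K) := rfl

theorem Rep.ofVN_injective : Function.Injective (Rep.ofVN π).act := fun _ _ h =>
  π.injective (Subtype.ext h)

/-- An operator commuting with the commutant of `π(M)` belongs to `π(M)`. -/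
theorem exists_of_commute (T : (Rep.ofVN π).space →L[ℂ] (Rep.ofVN π).space)
    (h : ∀ b : Intertwiner (Rep.ofVN π) (Rep.ofVN π), T ∘L b.1 = b.1 ∘L T) :
    ∃ a : M, (Rep.ofVN π).act a = T := by
  suffices h0 : (show K →L[ℂ] K from T) ∈ N.toStarSubalgebra from
    ⟨π.symm ⟨_, h0⟩, congrArg Subtype.val (π.apply_symm_apply ⟨_, h0⟩)⟩
  have h1 : (show K →L[ℂ] K from T) ∈ N.commutant.commutant := by
    rw [VonNeumannAlgebra.mem_commutant_iff]
    intro g hg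
    rw [VonNeumannAlgebra.mem_commutant_iff] at hg
    exact (h ⟨g, fun a => (hg (π a : K →L[ℂ] K) (π a).2).symm⟩).symm
  rwa [VonNeumannAlgebra.commutant_commutant] at h1

variable [PartialOrder M] [StarOrderedRing M] {E : Type u}
  [NormedAddCommGroup E] [NormedSpace ℂ E] [Module Mᵐᵒᵖ E] [HilbertModule M E]
  (φ : M →⋆ₙₐ[ℂ] Adjointable M E)

/-- The operators `T : K → ⊕ₙ E^{⊗ n} ⊗_π K` with `T b = (I ⊗ b) T` for all `b ∈ π(M)'`. -/
def fockSubmodule : Submodule ℂ ((Rep.ofVN π).space →L[ℂ] ((Rep.ofVN π).fock φ).space) where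
  carrier := {T | ∀ b : Intertwiner (Rep.ofVN π) (Rep.ofVN π), T ∘L b.1 = (Intertwiner.fock φ b).1 ∘L T}
  add_mem' h h' b := by
    rw [ContinuousLinearMap.add_comp, ContinuousLinearMap.comp_add, h b, h' b]
  zero_mem' b := by simp
  smul_mem' c T h b := by
    rw [ContinuousLinearMap.smul_comp, ContinuousLinearMap.comp_smul, h b]

/-- The full Fock space `𝓕(E) = E^{⊗ 0} ⊕ E^{⊗ 1} ⊕ E^{⊗ 2} ⊕ ⋯` of the correspondence `(E, φ)` over
`M` (`E^{⊗ 0} = M`), as a self-dual Hilbert module over `M`. It is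
realized as the space of operators `T : K → ⊕ₙ E^{⊗ n} ⊗_π K` with `T b = (I ⊗ b) T` for all `b` in
the commutant of `π(M)`, where `π` represents `M` faithfully as a von Neumann algebra on `K`; the
right action is `T · a = T π(a)` and the inner product is `⟨S, T⟩ = π⁻¹(S⋆ T)`.
A simple tensor `ξ₁ ⊗ ⋯ ⊗ ξₙ · a` is the operator `k ↦ ξ₁ ⊗ ⋯ ⊗ ξₙ ⊗ π(a) k`, and these span an
ultraweakly dense submodule: this is the self-dual completion of the algebraic Fock module. -/
def Fock : Type u := fockSubmodule π φ

namespace Fock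

variable {π φ}

instance : NormedAddCommGroup (Fock π φ) := inferInstanceAs (NormedAddCommGroup (fockSubmodule π φ))
instance : NormedSpace ℂ (Fock π φ) := inferInstanceAs (NormedSpace ℂ (fockSubmodule π φ))

/-- The operator underlying an element of the Fock space. -/
def op : Fock π φ →ₗ[ℂ] ((Rep.ofVN π).space →L[ℂ] ((Rep.ofVN π).fock φ).space) := (fockSubmodule π φ).subtype

theorem op_injective : Function.Injective (op (π := π) (φ := φ)) := Subtype.val_injective

theorem norm_op (T : Fock π φ) : ‖op T‖ = ‖T‖ := rfl

theorem op_comp (T : Fock π φ) (b : Intertwiner (Rep.ofVN π) (Rep.ofVN π)) :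
    op T ∘L b.1 = (Intertwiner.fock φ b).1 ∘L op T := T.2 b

/-- Build an element of the Fock space from an operator. -/
def mk (T : (Rep.ofVN π).space →L[ℂ] ((Rep.ofVN π).fock φ).space)
    (h : ∀ b : Intertwiner (Rep.ofVN π) (Rep.ofVN π), T ∘L b.1 = (Intertwiner.fock φ b).1 ∘L T) : Fock π φ :=
  ⟨T, h⟩

@[simp] theorem op_mk (T : (Rep.ofVN π).space →L[ℂ] ((Rep.ofVN π).fock φ).space) (h) : op (mk T h) = T := rfl

/-- The right action `T · a = T π(a)`. -/
instance : Module Mᵐᵒᵖ (Fock π φ) where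
  smul a T := mk (op T ∘L (Rep.ofVN π).act a.unop) fun b => by
    rw [ContinuousLinearMap.comp_assoc, ← b.2 a.unop, ← ContinuousLinearMap.comp_assoc, op_comp,
      ContinuousLinearMap.comp_assoc]
  one_smul T := op_injective (by
    have h : (Rep.ofVN π).act 1 = ContinuousLinearMap.id ℂ _ :=
      congrArg Subtype.val (map_one π)
    change op T ∘L (Rep.ofVN π).act 1 = op T
    rw [h, ContinuousLinearMap.comp_id])
  mul_smul a b T := op_injective (by
    change op T ∘L (Rep.ofVN π).act (b.unop * a.unop) = _
    rw [map_mul]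
    rfl)
  smul_zero a := op_injective (ContinuousLinearMap.zero_comp _)
  smul_add a S T := op_injective (ContinuousLinearMap.add_comp _ _ _)
  add_smul a b T := op_injective (by
    change op T ∘L (Rep.ofVN π).act (a.unop + b.unop) = _
    rw [map_add, ContinuousLinearMap.comp_add]
    rfl)
  zero_smul T := op_injective (by
    change op T ∘L (Rep.ofVN π).act 0 = 0
    rw [map_zero, ContinuousLinearMap.comp_zero])

theorem op_rsmul (T : Fock π φ) (a : M) :
    op (MulOpposite.op a • T) = op T ∘L (Rep.ofVN π).act a := rfl

theorem exists_inner (S T : Fock π φ) :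
    ∃ a : M, (Rep.ofVN π).act a = ContinuousLinearMap.adjoint (op S) ∘L op T := by
  refine exists_of_commute π _ fun b => ?_
  have h1 := congrArg ContinuousLinearMap.adjoint (op_comp S (Intertwiner.adj b))
  rw [ContinuousLinearMap.adjoint_comp, ContinuousLinearMap.adjoint_comp, Intertwiner.fock_adj,
    ContinuousLinearMap.adjoint_adjoint] at h1
  have h2 : ContinuousLinearMap.adjoint (Intertwiner.adj b).1 = b.1 :=
    ContinuousLinearMap.adjoint_adjoint _
  rw [h2] at h1
  rw [ContinuousLinearMap.comp_assoc, op_comp, ← ContinuousLinearMap.comp_assoc, ← h1,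
    ContinuousLinearMap.comp_assoc]

/-- The inner product `⟨S, T⟩ = π⁻¹(S⋆ T)`. -/
def inner (S T : Fock π φ) : M := (exists_inner S T).choose

theorem act_inner (S T : Fock π φ) :
    (Rep.ofVN π).act (inner S T) = ContinuousLinearMap.adjoint (op S) ∘L op T :=
  (exists_inner S T).choose_spec

theorem inner_nonneg (T : Fock π φ) : 0 ≤ inner T T := by
  have hsa : IsSelfAdjoint (inner T T) := Rep.ofVN_injective π (by
    rw [map_star, act_inner, ContinuousLinearMap.star_eq_adjoint,
      ContinuousLinearMap.adjoint_comp, ContinuousLinearMap.adjoint_adjoint])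
  obtain ⟨P, C, h1, h2⟩ := exists_negPart _ hsa
  have hC : C = 0 := Rep.ofVN_injective π (by
    rw [map_zero]
    ext k
    have h3 := congrArg (fun a => ⟪k, (Rep.ofVN π).act a k⟫_ℂ) h1
    simp only [map_mul, map_neg, map_star, act_inner, ContinuousLinearMap.star_eq_adjoint] at h3
    have h4 : ⟪k, -(ContinuousLinearMap.adjoint ((Rep.ofVN π).act C)
        ((Rep.ofVN π).act C k))⟫_ℂ
        = ⟪k, ContinuousLinearMap.adjoint ((Rep.ofVN π).act P)
            (ContinuousLinearMap.adjoint (op T) (op T ((Rep.ofVN π).act P k)))⟫_ℂ := h3.symm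
    rw [inner_neg_right, ContinuousLinearMap.adjoint_inner_right,
      ContinuousLinearMap.adjoint_inner_right, ContinuousLinearMap.adjoint_inner_right,
      inner_self_eq_norm_sq_to_K, inner_self_eq_norm_sq_to_K] at h4
    have h5 : -(‖(Rep.ofVN π).act C k‖ ^ 2) = ‖op T ((Rep.ofVN π).act P k)‖ ^ 2 := by
      exact_mod_cast h4
    have h6 : ‖(Rep.ofVN π).act C k‖ = 0 := by nlinarith [norm_nonneg ((Rep.ofVN π).act C k)]
    simpa using h6)
  obtain ⟨D, hD⟩ := h2 hC
  rw [hD]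
  exact star_mul_self_nonneg D

instance : HilbertModule M (Fock π φ) where
  ip := inner
  ip_add_right S T U := Rep.ofVN_injective π (by
    rw [map_add, act_inner, act_inner, act_inner, map_add, ContinuousLinearMap.comp_add])
  ip_smul_right c S T := Rep.ofVN_injective π (by
    rw [map_smul, act_inner, act_inner, map_smul, ContinuousLinearMap.comp_smul])
  ip_rsmul_right S T a := Rep.ofVN_injective π (by
    rw [map_mul, act_inner, act_inner, op_rsmul]
    rfl)
  star_ip S T := Rep.ofVN_injective π (by
    rw [map_star, act_inner, act_inner, ContinuousLinearMap.star_eq_adjoint,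
      ContinuousLinearMap.adjoint_comp, ContinuousLinearMap.adjoint_adjoint])
  ip_self_nonneg := inner_nonneg
  norm_sq_eq T := by
    rw [← NonUnitalStarAlgHom.norm_map _ (Rep.ofVN_injective π), act_inner,
      ContinuousLinearMap.norm_adjoint_comp_self, norm_op, sq]

theorem act_ip (S T : Fock π φ) :
    (Rep.ofVN π).act (ip M S T) = ContinuousLinearMap.adjoint (op S) ∘L op T := act_inner S T

theorem comp_mem {W : ((Rep.ofVN π).fock φ).space →L[ℂ] ((Rep.ofVN π).fock φ).space}
    (hW : ∀ b : Intertwiner (Rep.ofVN π) (Rep.ofVN π),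
      W ∘L (Intertwiner.fock φ b).1 = (Intertwiner.fock φ b).1 ∘L W) (T : Fock π φ)
    (b : Intertwiner (Rep.ofVN π) (Rep.ofVN π)) :
    (W ∘L op T) ∘L b.1 = (Intertwiner.fock φ b).1 ∘L (W ∘L op T) := by
  rw [ContinuousLinearMap.comp_assoc, op_comp, ← ContinuousLinearMap.comp_assoc, hW,
    ContinuousLinearMap.comp_assoc]

/-- Left multiplication `T ↦ W T` by an operator `W` commuting with all `I ⊗ b`, `b ∈ π(M)'`. -/
def leftMulAux (W : ((Rep.ofVN π).fock φ).space →L[ℂ] ((Rep.ofVN π).fock φ).space)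
    (hW : ∀ b : Intertwiner (Rep.ofVN π) (Rep.ofVN π),
      W ∘L (Intertwiner.fock φ b).1 = (Intertwiner.fock φ b).1 ∘L W) :
    Fock π φ →ₗ[ℂ] Fock π φ where
  toFun T := mk (W ∘L op T) (comp_mem hW T)
  map_add' _ _ := op_injective (ContinuousLinearMap.comp_add _ _ _)
  map_smul' _ _ := op_injective (ContinuousLinearMap.comp_smul _ _ _)

theorem norm_leftMulAux_le (W : ((Rep.ofVN π).fock φ).space →L[ℂ] ((Rep.ofVN π).fock φ).space)
    (hW : ∀ b : Intertwiner (Rep.ofVN π) (Rep.ofVN π),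
      W ∘L (Intertwiner.fock φ b).1 = (Intertwiner.fock φ b).1 ∘L W) (T : Fock π φ) :
    ‖leftMulAux W hW T‖ ≤ ‖W‖ * ‖T‖ := by
  have h : ‖W ∘L op T‖ ≤ ‖W‖ * ‖op T‖ := ContinuousLinearMap.opNorm_comp_le _ _
  exact h

/-- Left multiplication as a bounded operator. -/
def leftMul (W : ((Rep.ofVN π).fock φ).space →L[ℂ] ((Rep.ofVN π).fock φ).space)
    (hW : ∀ b : Intertwiner (Rep.ofVN π) (Rep.ofVN π),
      W ∘L (Intertwiner.fock φ b).1 = (Intertwiner.fock φ b).1 ∘L W) :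
    Fock π φ →L[ℂ] Fock π φ :=
  (leftMulAux W hW).mkContinuous ‖W‖ (norm_leftMulAux_le W hW)

theorem commute_adjoint {W : ((Rep.ofVN π).fock φ).space →L[ℂ] ((Rep.ofVN π).fock φ).space}
    (hW : ∀ b : Intertwiner (Rep.ofVN π) (Rep.ofVN π), W ∘L (Intertwiner.fock φ b).1 = (Intertwiner.fock φ b).1 ∘L W)
    (b : Intertwiner (Rep.ofVN π) (Rep.ofVN π)) :
    ContinuousLinearMap.adjoint W ∘L (Intertwiner.fock φ b).1
      = (Intertwiner.fock φ b).1 ∘L ContinuousLinearMap.adjoint W := by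
  have h1 := congrArg ContinuousLinearMap.adjoint (hW (Intertwiner.adj b))
  rw [ContinuousLinearMap.adjoint_comp, ContinuousLinearMap.adjoint_comp, Intertwiner.fock_adj,
    ContinuousLinearMap.adjoint_adjoint] at h1
  exact h1.symm

/-- `leftMul` as an adjointable operator. -/
def leftMulAdj (W : ((Rep.ofVN π).fock φ).space →L[ℂ] ((Rep.ofVN π).fock φ).space)
    (hW : ∀ b : Intertwiner (Rep.ofVN π) (Rep.ofVN π), W ∘L (Intertwiner.fock φ b).1 = (Intertwiner.fock φ b).1 ∘L W) :
    Adjointable M (Fock π φ) :=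
  ⟨leftMul W hW, leftMul (ContinuousLinearMap.adjoint W) (commute_adjoint hW), fun S T =>
    Rep.ofVN_injective π (by
      rw [act_ip, act_ip]
      change ContinuousLinearMap.adjoint (W ∘L op S) ∘L op T
        = ContinuousLinearMap.adjoint (op S) ∘L (ContinuousLinearMap.adjoint W ∘L op T)
      rw [ContinuousLinearMap.adjoint_comp, ContinuousLinearMap.comp_assoc])⟩

theorem op_leftMulAdj (W : ((Rep.ofVN π).fock φ).space →L[ℂ] ((Rep.ofVN π).fock φ).space) (hW)
    (T : Fock π φ) : op ((leftMulAdj W hW).1 T) = W ∘L op T := rfl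

variable (π φ)

/-- The left action `φ_∞(a) = diag(φ₀(a), φ₁(a), φ₂(a), …)` of `M` on `𝓕(E)`. -/
def leftAct : M →⋆ₙₐ[ℂ] Adjointable M (Fock π φ) where
  toFun a := leftMulAdj (((Rep.ofVN π).fock φ).act a) fun b => ((Intertwiner.fock φ b).2 a).symm
  map_smul' c a := Subtype.ext <| ContinuousLinearMap.ext fun T => op_injective <| by
    change ((Rep.ofVN π).fock φ).act (c • a) ∘L op T = c • (((Rep.ofVN π).fock φ).act a ∘L op T)
    rw [map_smul, ContinuousLinearMap.smul_comp]
  map_zero' := Subtype.ext <| ContinuousLinearMap.ext fun T => op_injective <| by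
    change ((Rep.ofVN π).fock φ).act 0 ∘L op T = 0
    rw [map_zero, ContinuousLinearMap.zero_comp]
  map_add' a b := Subtype.ext <| ContinuousLinearMap.ext fun T => op_injective <| by
    change ((Rep.ofVN π).fock φ).act (a + b) ∘L op T
      = ((Rep.ofVN π).fock φ).act a ∘L op T + ((Rep.ofVN π).fock φ).act b ∘L op T
    rw [map_add, ContinuousLinearMap.add_comp]
  map_mul' a b := Subtype.ext <| ContinuousLinearMap.ext fun T => op_injective <| by
    change ((Rep.ofVN π).fock φ).act (a * b) ∘L op T
      = ((Rep.ofVN π).fock φ).act a ∘L (((Rep.ofVN π).fock φ).act b ∘L op T)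
    rw [map_mul]
    rfl
  map_star' a := Adjointable.eq_star fun S T => Rep.ofVN_injective π (by
    rw [act_ip, act_ip, op_leftMulAdj, op_leftMulAdj, map_star,
      ContinuousLinearMap.star_eq_adjoint, ContinuousLinearMap.adjoint_comp,
      ContinuousLinearMap.comp_assoc])

theorem leftAct_op (a : M) (T : Fock π φ) :
    op ((leftAct π φ a).1 T) = ((Rep.ofVN π).fock φ).act a ∘L op T := rfl

/-- The creation operator `T_ξ η = ξ ⊗ η` on `𝓕(E)`. -/
def creation (ξ : E) : Adjointable M (Fock π φ) :=
  leftMulAdj ((Rep.ofVN π).shift φ ξ) fun b => Rep.shift_fock φ b ξ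

/-- The vector `1_M ∈ M = E^{⊗ 0} ⊆ 𝓕(E)`. -/
def vacuum : Fock π φ := mk (Intertwiner.zeroth φ (Rep.ofVN π)).1 (Intertwiner.zeroth_fock φ)

/-- `T_ξ⋆ T_ζ = φ_∞(⟨ξ, ζ⟩)`. -/
theorem ip_creation (ξ ζ : E) (S T : Fock π φ) :
    ip M ((creation π φ ξ).1 S) ((creation π φ ζ).1 T)
      = ip M S ((leftAct π φ (ip M ξ ζ)).1 T) := Rep.ofVN_injective π (by
  rw [act_ip, act_ip, creation, creation, op_leftMulAdj, op_leftMulAdj, leftAct_op,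
    ContinuousLinearMap.adjoint_comp, ← Rep.adjoint_shift_comp]
  rfl)

/-- `1_M · a = φ_∞(a) 1_M`. -/
theorem leftAct_vacuum (a : M) :
    (leftAct π φ a).1 (vacuum π φ) = MulOpposite.op a • vacuum π φ :=
  op_injective ((Intertwiner.zeroth φ (Rep.ofVN π)).2 a).symm

end Fock

end FockModule

section Powers

variable {M : Type v} [CStarAlgebra M] [PartialOrder M] [StarOrderedRing M] {E : Type u}
  [NormedAddCommGroup E] [NormedSpace ℂ E] [Module Mᵐᵒᵖ E] [HilbertModule M E]

namespace Tensor

variable {R : Rep.{v, w} M}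

theorem tmul_add_left (ξ ζ : E) (h : R.space) :
    tmul M (ξ + ζ) h = tmul M ξ h + tmul M ζ h :=
  ext_inner fun θ k => by
    rw [inner_add_right, inner_tmul, inner_tmul, inner_tmul, ip_add_right, map_add, add_apply,
      inner_add_right]

theorem tmul_smul_left (c : ℂ) (ξ : E) (h : R.space) : tmul M (c • ξ) h = c • tmul M ξ h :=
  ext_inner fun θ k => by
    rw [inner_smul_right, inner_tmul, inner_tmul, ip_smul_right, map_smul, smul_apply,
      inner_smul_right]

/-- `ξ a ⊗ h = ξ ⊗ σ(a) h`. -/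
theorem tmul_rsmul (ξ : E) (a : M) (h : R.space) :
    tmul M (MulOpposite.op a • ξ) h = tmul M ξ (R.act a h) :=
  ext_inner fun θ k => by
    rw [inner_tmul, inner_tmul, ip_rsmul_right, map_mul]
    rfl

end Tensor

variable {K : Type u} [NormedAddCommGroup K] [InnerProductSpace ℂ K] [CompleteSpace K]
  {N : VonNeumannAlgebra K} (π : M ≃⋆ₐ[ℂ] N.toStarSubalgebra)
  (φ : M →⋆ₙₐ[ℂ] Adjointable M E)

namespace Fock

theorem creation_add (ξ ζ : E) : creation π φ (ξ + ζ) = creation π φ ξ + creation π φ ζ :=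
  Subtype.ext <| ContinuousLinearMap.ext fun T => op_injective <| by
    have h : shift φ (Rep.ofVN π) (ξ + ζ) = shift φ (Rep.ofVN π) ξ + shift φ (Rep.ofVN π) ζ := by
      ext f n
      cases n with
      | zero => exact (add_zero _).symm
      | succ n => exact Tensor.tmul_add_left ξ ζ (f n)
    change shift φ (Rep.ofVN π) (ξ + ζ) ∘L op T
      = shift φ (Rep.ofVN π) ξ ∘L op T + shift φ (Rep.ofVN π) ζ ∘L op T
    rw [h]
    rfl

theorem creation_smul (c : ℂ) (ξ : E) : creation π φ (c • ξ) = c • creation π φ ξ :=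
  Subtype.ext <| ContinuousLinearMap.ext fun T => op_injective <| by
    have h : shift φ (Rep.ofVN π) (c • ξ) = c • shift φ (Rep.ofVN π) ξ := by
      ext f n
      cases n with
      | zero => exact (smul_zero c).symm
      | succ n => exact Tensor.tmul_smul_left c ξ (f n)
    change shift φ (Rep.ofVN π) (c • ξ) ∘L op T = c • (shift φ (Rep.ofVN π) ξ ∘L op T)
    rw [h]
    rfl

theorem creation_left (a : M) (ξ : E) :
    creation π φ ((φ a).1 ξ) = leftAct π φ a * creation π φ ξ :=
  Subtype.ext <| ContinuousLinearMap.ext fun T => op_injective <| by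
    have h : shift φ (Rep.ofVN π) ((φ a).1 ξ)
        = fockAct φ (Rep.ofVN π) a ∘L shift φ (Rep.ofVN π) ξ := by
      ext f n
      cases n with
      | zero => exact (map_zero ((level φ (Rep.ofVN π) 0).act a)).symm
      | succ n => exact (Tensor.map_tmul (φ a) (Intertwiner.id _) ξ (f n)).symm
    change shift φ (Rep.ofVN π) ((φ a).1 ξ) ∘L op T
      = fockAct φ (Rep.ofVN π) a ∘L (shift φ (Rep.ofVN π) ξ ∘L op T)
    rw [h]
    rfl

theorem star_creation_mul (ξ ζ : E) :
    star (creation π φ ξ) * creation π φ ζ = leftAct π φ (ip M ξ ζ) :=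
  Subtype.ext <| ContinuousLinearMap.ext fun T => ip_ext M fun S => by
    change ip M S ((star (creation π φ ξ)).1 ((creation π φ ζ).1 T)) = _
    rw [← Adjointable.ip_left, ip_creation]

end Fock

variable (R : Rep.{v, w} M)

/-- The Hilbert space `𝓕(E) ⊗_σ H` with the left action `φ_∞(·) ⊗ I_H` of `M`. -/
abbrev Rep.fockInduced : Rep.{v, max u w} M := R.induced (Fock.leftAct π φ)

/-- The map `ξ ⊗ y ↦ (T_ξ ⊗ I_H) y` on the algebraic tensor product. -/
def shiftLin : PreTensor M E (R.fockInduced π φ) →ₗ[ℂ] Tensor M (Fock π φ) R :=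
  TensorProduct.lift <| LinearMap.mk₂ ℂ
    (fun (ξ : E) (y : Tensor M (Fock π φ) R) => Tensor.amp R (Fock.creation π φ ξ) y)
    (fun ξ ζ y => by rw [Fock.creation_add, map_add]; rfl)
    (fun c ξ y => by rw [Fock.creation_smul, map_smul]; rfl)
    (fun ξ y z => map_add _ _ _)
    (fun c ξ y => map_smul _ _ _)

theorem shiftLin_tmul (ξ : E) (y : (R.fockInduced π φ).space) :
    shiftLin π φ R (PreTensor.tmul M ξ y) = Tensor.amp R (Fock.creation π φ ξ) y := rfl

theorem inner_shiftLin (x y : PreTensor M E (R.fockInduced π φ)) :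
    ⟪shiftLin π φ R x, shiftLin π φ R y⟫_ℂ = ⟪x, y⟫_ℂ := by
  induction x using PreTensor.induction with
  | zero => simp
  | add x x' hx hx' => rw [map_add, inner_add_left, inner_add_left, hx, hx']
  | tmul ξ x =>
    induction y using PreTensor.induction with
    | zero => simp
    | add y y' hy hy' => rw [map_add, inner_add_right, inner_add_right, hy, hy']
    | tmul ζ y =>
      rw [shiftLin_tmul, shiftLin_tmul, PreTensor.inner_tmul]
      change _ = ⟪x, Tensor.amp R (Fock.leftAct π φ (ip M ξ ζ)) y⟫_ℂ
      rw [← Fock.star_creation_mul, map_mul, map_star, ContinuousLinearMap.star_eq_adjoint]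
      exact (ContinuousLinearMap.adjoint_inner_right _ _ _).symm

theorem norm_shiftLin (x : PreTensor M E (R.fockInduced π φ)) : ‖shiftLin π φ R x‖ = ‖x‖ := by
  rw [@norm_eq_sqrt_re_inner ℂ, @norm_eq_sqrt_re_inner ℂ, inner_shiftLin]

/-- The canonical isometry `E ⊗ (𝓕(E) ⊗_σ H) → 𝓕(E) ⊗_σ H`, `ξ ⊗ y ↦ (T_ξ ⊗ I_H) y`, which
identifies `E ⊗ (E^{⊗ n} ⊗_σ H)` with `E^{⊗ (n + 1)} ⊗_σ H`. -/
def shiftMap : Tensor M E (R.fockInduced π φ) →L[ℂ] Tensor M (Fock π φ) R :=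
  ((shiftLin π φ R).mkContinuous 1 fun x => by
    rw [one_mul]
    exact (norm_shiftLin π φ R x).le).fromCompletion

theorem shiftMap_tmul (ξ : E) (y : (R.fockInduced π φ).space) :
    shiftMap π φ R (Tensor.tmul M ξ y) = Tensor.amp R (Fock.creation π φ ξ) y := by
  rw [shiftMap, Tensor.tmul_apply, ContinuousLinearMap.fromCompletion_apply_coe]
  rfl

/-- `shiftMap` commutes with the left actions of `M`. -/
def Intertwiner.shiftMap : Intertwiner ((R.fockInduced π φ).induced φ) (R.fockInduced π φ) :=
  ⟨HardyPoisson.shiftMap π φ R, fun a => Tensor.ext fun ξ y => by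
    change HardyPoisson.shiftMap π φ R (Tensor.map (φ a) _ (Tensor.tmul M ξ y))
      = Tensor.amp R (Fock.leftAct π φ a) (HardyPoisson.shiftMap π φ R (Tensor.tmul M ξ y))
    rw [Tensor.map_tmul, shiftMap_tmul, shiftMap_tmul, Fock.creation_left, map_mul]
    rfl⟩

/-- The operator `h ↦ 1_M ⊗ h` from `H` onto `E^{⊗ 0} ⊗_σ H = M ⊗_σ H ⊆ 𝓕(E) ⊗_σ H`. -/
def Intertwiner.vacuum : Intertwiner R (R.fockInduced π φ) :=
  ⟨Tensor.tmul M (Fock.vacuum π φ), fun a => by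
    ext h
    change Tensor.tmul M (Fock.vacuum π φ) (R.act a h)
      = Tensor.amp R (Fock.leftAct π φ a) (Tensor.tmul M (Fock.vacuum π φ) h)
    rw [← Tensor.tmul_rsmul, ← Fock.leftAct_vacuum]
    exact (Tensor.map_tmul (Fock.leftAct π φ a) (Intertwiner.id R) _ h).symm⟩

/-- Composition of intertwiners. -/
def Intertwiner.comp {R₁ : Rep.{v, w} M} {R₂ : Rep.{v, w'} M} {R₃ : Rep.{v, w''} M}
    (S : Intertwiner R₂ R₃) (T : Intertwiner R₁ R₂) : Intertwiner R₁ R₃ :=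
  ⟨S.1 ∘L T.1, fun a => by
    rw [ContinuousLinearMap.comp_assoc, T.2, ← ContinuousLinearMap.comp_assoc, S.2,
      ContinuousLinearMap.comp_assoc]⟩

variable {R φ}

/-- The generalized powers `η^{(n)} : H → E^{⊗ n} ⊗_σ H ⊆ 𝓕(E) ⊗_σ H` of `η ∈ E^σ`:
`η^{(0)} = I_H` and `η^{(n + 1)} = (I_E ⊗ η^{(n)}) η`. -/
def genPower (η : Intertwiner R (R.induced φ)) : ℕ → Intertwiner R (R.fockInduced π φ)
  | 0 => Intertwiner.vacuum π φ R
  | n + 1 => Intertwiner.comp (Intertwiner.shiftMap π φ R)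
      (Intertwiner.comp (Intertwiner.induced φ (genPower η n)) η)

theorem norm_shiftMap_le : ‖shiftMap π φ R‖ ≤ 1 := by
  refine ContinuousLinearMap.opNorm_le_bound _ zero_le_one fun x => ?_
  induction x using UniformSpace.Completion.induction_on with
  | hp => exact isClosed_le (by fun_prop) (by fun_prop)
  | ih x =>
    rw [shiftMap, ContinuousLinearMap.fromCompletion_apply_coe, UniformSpace.Completion.norm_coe,
      one_mul]
    exact (norm_shiftLin π φ R x).le

theorem norm_genPower_succ_le (η : Intertwiner R (R.induced φ)) (n : ℕ) :
    ‖genPower π η (n + 1)‖ ≤ ‖genPower π η n‖ * ‖η‖ := by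
  change ‖HardyPoisson.shiftMap π φ R ∘L (Tensor.map 1 (genPower π η n) ∘L η.1)‖
    ≤ ‖(genPower π η n).1‖ * ‖η.1‖
  calc _ ≤ ‖shiftMap π φ R‖ * (‖Tensor.map (1 : Adjointable M E) (genPower π η n)‖ * ‖η.1‖) :=
        (ContinuousLinearMap.opNorm_comp_le _ _).trans
          (mul_le_mul_of_nonneg_left (ContinuousLinearMap.opNorm_comp_le _ _) (norm_nonneg _))
    _ ≤ 1 * (‖(genPower π η n).1‖ * ‖η.1‖) := by
        gcongr
        · exact norm_shiftMap_le π
        · exact Tensor.norm_map_one_le _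
    _ = _ := one_mul _

/-- For `‖η‖ < 1` the column `[η^{(0)}, η^{(1)}, …]ᵀ` is a norm convergent series. -/
theorem summable_genPower (η : Intertwiner R (R.induced φ)) (hη : ‖η‖ < 1) :
    Summable fun n => (genPower π η n).1 := by
  refine Summable.of_norm_bounded (g := fun n => ‖genPower π η 0‖ * ‖η‖ ^ n)
    ((summable_geometric_of_lt_one (norm_nonneg _) hη).mul_left _) fun n => ?_
  induction n with
  | zero => simp
  | succ n ih =>
    refine (norm_genPower_succ_le π η n).trans ?_
    rw [pow_succ, ← mul_assoc]
    exact mul_le_mul_of_nonneg_right ih (norm_nonneg _)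

/-- The Cauchy kernel `C(η) = [η^{(0)}, η^{(1)}, η^{(2)}, …]ᵀ : H → 𝓕(E) ⊗_σ H`. -/
def cauchyKernel (η : Intertwiner R (R.induced φ)) :
    R.space →L[ℂ] (R.fockInduced π φ).space :=
  ∑' n, (genPower π η n).1

/-- The defect operator `Δ_*(η) = (I_H - η⋆ η)^{1/2}`, which commutes with `σ(M)`. -/
def defect (η : Intertwiner R (R.induced φ)) : Intertwiner R R :=
  ⟨CFC.sqrt (1 - ContinuousLinearMap.adjoint η.1 ∘L η.1), fun a => by
    have h1 : Commute (1 - ContinuousLinearMap.adjoint η.1 ∘L η.1) (R.act a) := by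
      refine (Commute.one_left _).sub_left ?_
      exact (Intertwiner.comp (Intertwiner.adj η) η).2 a
    exact (h1.cfcₙ_nnreal _)⟩

/-- The Poisson kernel `K(η) = (I_{𝓕(E)} ⊗ Δ_*(η)) C(η) : H → 𝓕(E) ⊗_σ H`. -/
def poissonKernel (η : Intertwiner R (R.induced φ)) :
    R.space →L[ℂ] (R.fockInduced π φ).space :=
  (Intertwiner.induced (Fock.leftAct π φ) (defect η)).1 ∘L cauchyKernel π η

end Powers

section Hardy

/-- The ultraweak topology of a W⋆-algebra: the initial topology of the normal positive
functionals (a linear functional which preserves suprema of directed sets is automatically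
positive, and the normal positive functionals span the predual). -/
abbrev ultraweak (A : Type*) [AddCommMonoid A] [Module ℂ A] [Preorder A] : TopologicalSpace A :=
  ⨅ ω : {ω : A →ₗ[ℂ] ℂ // ScottContinuous ω}, TopologicalSpace.induced ω.1 inferInstance

variable {M : Type v} [CStarAlgebra M] [PartialOrder M] [StarOrderedRing M] {E : Type u}
  [NormedAddCommGroup E] [NormedSpace ℂ E] [Module Mᵐᵒᵖ E] [HilbertModule M E]
  {K : Type u} [NormedAddCommGroup K] [InnerProductSpace ℂ K] [CompleteSpace K]
  {N : VonNeumannAlgebra K} (π : M ≃⋆ₐ[ℂ] N.toStarSubalgebra)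
  (φ : M →⋆ₙₐ[ℂ] Adjointable M E)

/-- The Hardy algebra `H^∞(E)`: the smallest ultraweakly closed subalgebra of `𝓛(𝓕(E))`
containing the operators `T_ξ`, `ξ ∈ E`, and `φ_∞(a)`, `a ∈ M`. -/
def hardyAlgebra : NonUnitalSubalgebra ℂ (Adjointable M (Fock π φ)) :=
  sInf {S | (∀ ξ, Fock.creation π φ ξ ∈ S) ∧ (∀ a, Fock.leftAct π φ a ∈ S) ∧
    IsClosed[ultraweak (Adjointable M (Fock π φ))] (S : Set (Adjointable M (Fock π φ)))}

theorem creation_mem_hardyAlgebra (ξ : E) : Fock.creation π φ ξ ∈ hardyAlgebra π φ :=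
  NonUnitalAlgebra.mem_sInf.mpr fun _ h => h.1 ξ

theorem leftAct_mem_hardyAlgebra (a : M) : Fock.leftAct π φ a ∈ hardyAlgebra π φ :=
  NonUnitalAlgebra.mem_sInf.mpr fun _ h => h.2.1 a

variable {φ} {R : Rep.{v, w} M}

/-- `ρ` is the integrated form `σ × η̂⋆` of the covariant pair `(η̂⋆, σ)`: the ultraweakly continuous
representation of `H^∞(E)` with `φ_∞(a) ↦ σ(a)` and `T_ξ ↦ η̂⋆(ξ)`,
where `η̂⋆(ξ) h = η⋆(ξ ⊗ h)`. -/
structure IsIntegratedForm (η : Intertwiner R (R.induced φ))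
    (ρ : hardyAlgebra π φ →ₙₐ[ℂ] (R.space →L[ℂ] R.space)) : Prop where
  map_leftAct : ∀ a, ρ ⟨Fock.leftAct π φ a, leftAct_mem_hardyAlgebra π φ a⟩ = R.act a
  map_creation : ∀ ξ, ρ ⟨Fock.creation π φ ξ, creation_mem_hardyAlgebra π φ ξ⟩
    = ContinuousLinearMap.adjoint η.1 ∘L Tensor.tmul M ξ
  continuous : Continuous[TopologicalSpace.induced Subtype.val (ultraweak _), ultraweak _] ρ

open Classical in
/-- The Fourier transform `X̂(η⋆) = (σ × η̂⋆)(X)` of `X ∈ H^∞(E)`. -/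
def fourierTransform (X : hardyAlgebra π φ) (η : Intertwiner R (R.induced φ)) :
    R.space →L[ℂ] R.space :=
  if h : ∃ ρ, IsIntegratedForm π η ρ then h.choose X else 0

end Hardy

end HardyPoisson

end

open HardyPoisson

noncomputable section

namespace HardyPoisson

open HilbertModule

/-! ### Suprema of directed sets of operators as weak limits. -/

section OperatorOrder

open Filter

variable {H : Type*} [NormedAddCommGroup H] [InnerProductSpace ℂ H]

/-! Write $K$ for the Poisson kernel, $V$ for the vacuum embedding $h\mapsto 1\otimes h$ and $S$ for
the isometry $\xi\otimes y\mapsto(T_\xi\otimes I)y$. The series for $C(\eta)$ reproduces itself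
after its first term, which gives $K = V\Delta_* + S(I_E\otimes K)\eta$ (`poissonKernel_eq`). Since
$V$ and $S$ are isometries with orthogonal ranges, $Q=K^*K$ solves $Q =
(I-\eta^*\eta)+\eta^*(I_E\otimes Q)\eta$. The identity solves it too, and the difference of the two
solutions is bounded by $\|\eta\|^2$ times itself, so $K$ is an isometry
(`adjoint_poissonKernel_comp`).

Applying $T_\xi^*\otimes I$ to the recursion kills the vacuum term and strips off the shift:
$(T_\xi^*\otimes I)K=K\,\widehat{\eta^*}(\xi)^*$. Also $K$ intertwines $\sigma$ with
$\varphi_\infty\otimes I$. Hence each generator $X$ satisfies $K^*(X\otimes I)=\widehat X K^*$ with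
$\widehat X=K^*(X\otimes I)K$. The operators with this property form an ultraweakly closed algebra
(`coinvariant`, `isClosed_coinvariant`), which therefore contains $H^\infty(E)$. On that algebra the
compression $X\mapsto\widehat X$ is multiplicative, so it is the integrated form; the first formula
is the adjoint of the defining relation, the second is the definition of $\widehat X$.

The analytic input is that $X\mapsto X\otimes I_H$ preserves suprema of directed sets, the ultraweak
topology being defined by the functionals that do. On $\mathcal F(E)\otimes_\pi K$, with $\pi$
faithful onto a von Neumann algebra, such a supremum is a weak limit, so it commutes with all
$I\otimes b$, $b\in\pi(M)'$, and comes from an adjointable operator. Hence $X\mapsto\langle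
T,XT\rangle$ is normal (`Fock.scottContinuous_ip`). For any normal $\sigma$, the excess of $X\otimes
I_H$ over the supremum of the amplified set is a positive operator with vanishing diagonal
coefficients at simple tensors, hence zero (`Tensor.scottContinuous_amp`).

For uniqueness, two integrated forms agree on an ultraweakly closed subalgebra containing the
generators. -/

theorem opNonneg_iff_inner {T : H →L[ℂ] H} : 0 ≤ T ↔ ∀ x, 0 ≤ ⟪x, T x⟫_ℂ := by
  rw [ContinuousLinearMap.nonneg_iff_isPositive]
  refine ⟨fun h x => h.inner_nonneg_right x, fun h => ?_⟩
  rw [ContinuousLinearMap.isPositive_iff_complex]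
  intro x
  have h1 := h x
  rw [← inner_conj_symm, Complex.nonneg_iff] at h1
  simp only [Complex.conj_re, Complex.conj_im] at h1
  refine ⟨Complex.ext rfl ?_, h1.1⟩
  simp only [Complex.ofReal_im, RCLike.re_eq_complex_re]
  linarith [h1.2]

theorem opLe_iff_inner {S T : H →L[ℂ] H} : S ≤ T ↔ ∀ x, ⟪x, S x⟫_ℂ ≤ ⟪x, T x⟫_ℂ := by
  rw [ContinuousLinearMap.le_def, ← ContinuousLinearMap.nonneg_iff_isPositive, opNonneg_iff_inner]
  simp only [sub_apply, inner_sub_right, sub_nonneg]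

/-- The operator order is tested on vectors, so least upper bounds of all quadratic forms give one
for the operators. This reduces normality of a map into $B(H)$ to its vector functionals. -/
theorem isLUB_of_forall_inner {D : Set (H →L[ℂ] H)} {T : H →L[ℂ] H}
    (h : ∀ x, IsLUB ((fun S : H →L[ℂ] H => ⟪x, S x⟫_ℂ) '' D) ⟪x, T x⟫_ℂ) : IsLUB D T := by
  refine ⟨fun S hS => opLe_iff_inner.mpr fun x => (h x).1 ⟨S, hS, rfl⟩, fun U hU =>
    opLe_iff_inner.mpr fun x => (h x).2 ?_⟩
  rintro _ ⟨S, hS, rfl⟩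
  exact opLe_iff_inner.mp (hU hS) x

theorem scottContinuous_of_forall_inner {α : Type*} [Preorder α] {f : α → H →L[ℂ] H}
    (h : ∀ x, ScottContinuous fun a => ⟪x, f a x⟫_ℂ) : ScottContinuous f := by
  intro D hn hd a ha
  refine isLUB_of_forall_inner fun x => ?_
  rw [Set.image_image]
  exact h x hn hd ha

/-- Monotone nets in `ℂ` which are bounded above converge. -/
theorem exists_tendsto_of_monotone {ι : Type*} [Preorder ι] [IsDirectedOrder ι] [Nonempty ι]
    {f : ι → ℂ} (hf : Monotone f) {c : ℂ} (hc : ∀ i, f i ≤ c) : ∃ z, Tendsto f atTop (𝓝 z) := by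
  -- Comparable complex numbers have equal imaginary parts, so every `f i` has imaginary part `c.im`
  -- and only the real parts have to converge.
  have h1 := tendsto_atTop_ciSup (f := fun i => (f i).re) (fun i j h => (Complex.le_def.mp (hf h)).1)
    ⟨c.re, by rintro _ ⟨i, rfl⟩; exact (Complex.le_def.mp (hc i)).1⟩
  refine ⟨_, ((Complex.continuous_ofReal.tendsto _).comp h1).add
    (tendsto_const_nhds (x := (c.im : ℂ) * Complex.I)) |>.congr fun i => ?_⟩
  rw [← (Complex.le_def.mp (hc i)).2]
  exact Complex.re_add_im (f i)

variable [CompleteSpace H]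

/-- From $0\le T-S\le U-S$ and monotonicity of the norm on positive elements. It bounds an order
interval in norm. -/
theorem norm_le_of_mem_Icc {S T U : H →L[ℂ] H} (h1 : S ≤ T) (h2 : T ≤ U) :
    ‖T‖ ≤ ‖S‖ + ‖U - S‖ := by
  have h3 : ‖T - S‖ ≤ ‖U - S‖ :=
    CStarAlgebra.norm_le_norm_of_nonneg_of_le (sub_nonneg.mpr h1) (sub_le_sub_right h2 S)
  calc ‖T‖ = ‖S + (T - S)‖ := by rw [add_sub_cancel]
    _ ≤ _ := (norm_add_le _ _).trans (by gcongr)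

/-- Directed sets of operators which are bounded above converge weakly to their supremum. -/
theorem exists_isLUB_tendsto_inner {D : Set (H →L[ℂ] H)} (hn : D.Nonempty)
    (hd : DirectedOn (· ≤ ·) D) (hb : BddAbove D) :
    ∃ Y, IsLUB D Y ∧ ∀ x y, Tendsto (fun T : D => ⟪x, T.1 y⟫_ℂ) atTop (𝓝 ⟪x, Y y⟫_ℂ) := by
  obtain ⟨U, hU⟩ := hb
  obtain ⟨T₀, hT₀⟩ := hn
  have : Nonempty D := ⟨⟨T₀, hT₀⟩⟩
  have : IsDirectedOrder D := ⟨fun a b => by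
    obtain ⟨c, hc, h1, h2⟩ := hd a.1 a.2 b.1 b.2
    exact ⟨⟨c, hc⟩, h1, h2⟩⟩
  have hquad : ∀ x, ∃ z, Tendsto (fun T : D => ⟪T.1 x, x⟫_ℂ) atTop (𝓝 z) := fun x => by
    have hle : ∀ {S T : H →L[ℂ] H}, S ≤ T → ⟪S x, x⟫_ℂ ≤ ⟪T x, x⟫_ℂ := fun {S T} h => by
      have := h.inner_nonneg_left x
      rwa [sub_apply, inner_sub_left, sub_nonneg] at this
    exact exists_tendsto_of_monotone (fun S T h => hle h) (fun T => hle (hU T.2))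
  -- Polarization: each coefficient is a fixed combination of four quadratic forms, all of which
  -- converge.
  have hlim : ∀ x y, ∃ z, Tendsto (fun T : D => ⟪T.1 x, y⟫_ℂ) atTop (𝓝 z) := fun x y => by
    obtain ⟨a, ha⟩ := hquad (y + x)
    obtain ⟨b, hb⟩ := hquad (y - x)
    obtain ⟨c, hc⟩ := hquad (y + Complex.I • x)
    obtain ⟨d, hd⟩ := hquad (y - Complex.I • x)
    refine ⟨_, ((((ha.sub hb).add (hc.const_mul Complex.I)).sub
      (hd.const_mul Complex.I)).div_const 4).congr fun T => ?_⟩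
    exact (inner_map_polarization (T.1 : H →ₗ[ℂ] H) y x).symm
  choose B hB using hlim
  have huniq : ∀ {f : D → ℂ} {a b : ℂ}, Tendsto f atTop (𝓝 a) → Tendsto f atTop (𝓝 b) → a = b :=
    fun h h' => tendsto_nhds_unique h h'
  let L : H →L⋆[ℂ] H →L[ℂ] ℂ := LinearMap.mkContinuous₂
    (LinearMap.mk₂'ₛₗ (starRingEnd ℂ) (RingHom.id ℂ) B
      (fun x x' y => huniq (hB _ _) (((hB x y).add (hB x' y)).congr fun T => by
        rw [map_add, inner_add_left]))
      (fun c x y => huniq (hB _ _) (((hB x y).const_mul (starRingEnd ℂ c)).congr fun T => by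
        rw [map_smul, inner_smul_left]))
      (fun x y y' => huniq (hB _ _) (((hB x y).add (hB x y')).congr fun T => by
        rw [inner_add_right]))
      (fun c x y => huniq (hB _ _) (((hB x y).const_mul c).congr fun T => by
        rw [inner_smul_right])))
    -- `D` need not be norm bounded, but its tail above `T₀` lies in the interval between `T₀` and
    -- `U`, and the limit only sees the tail.
    (‖T₀‖ + ‖U - T₀‖) fun x y => by
      refine le_of_tendsto (hB x y).norm ?_
      filter_upwards [eventually_ge_atTop (⟨T₀, hT₀⟩ : D)] with T hT
      refine (norm_inner_le_norm _ _).trans ?_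
      gcongr
      exact (T.1.le_opNorm x).trans (by gcongr; exact norm_le_of_mem_Icc hT (hU T.2))
  let Y := InnerProductSpace.continuousLinearMapOfBilin L
  have hY : ∀ x y, Tendsto (fun T : D => ⟪T.1 x, y⟫_ℂ) atTop (𝓝 ⟪Y x, y⟫_ℂ) := fun x y => by
    rw [InnerProductSpace.continuousLinearMapOfBilin_apply]
    exact hB x y
  have hY' : ∀ x y, Tendsto (fun T : D => ⟪x, T.1 y⟫_ℂ) atTop (𝓝 ⟪x, Y y⟫_ℂ) := fun x y => by
    rw [← inner_conj_symm]
    exact ((Complex.continuous_conj.tendsto _).comp (hY y x)).congr fun T => inner_conj_symm _ _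
  refine ⟨Y, ⟨fun T hT => opLe_iff_inner.mpr fun x => ?_, fun V hV =>
    opLe_iff_inner.mpr fun x => ?_⟩, hY'⟩
  · refine ge_of_tendsto (hY' x x) ?_
    filter_upwards [eventually_ge_atTop (⟨T, hT⟩ : D)] with S hS
    exact opLe_iff_inner.mp hS x
  · exact le_of_tendsto (hY' x x) (Eventually.of_forall fun T => opLe_iff_inner.mp (hV T.2) x)

theorem tendsto_inner_of_isLUB {D : Set (H →L[ℂ] H)} (hn : D.Nonempty)
    (hd : DirectedOn (· ≤ ·) D) {T : H →L[ℂ] H} (hT : IsLUB D T) (x y : H) :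
    Tendsto (fun S : D => ⟪x, S.1 y⟫_ℂ) atTop (𝓝 ⟪x, T y⟫_ℂ) := by
  obtain ⟨Y, hY, h⟩ := exists_isLUB_tendsto_inner hn hd ⟨T, hT.1⟩
  rw [hT.unique hY]
  exact h x y

/-- The supremum is a weak limit, and multiplication by a fixed `A` on either side is weakly
continuous: on the left, `A` moves to the other slot as its adjoint. -/
theorem comm_of_isLUB {D : Set (H →L[ℂ] H)} (hn : D.Nonempty) (hd : DirectedOn (· ≤ ·) D)
    {T : H →L[ℂ] H} (hT : IsLUB D T) {A : H →L[ℂ] H} (hA : ∀ S ∈ D, S ∘L A = A ∘L S) :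
    T ∘L A = A ∘L T := by
  have : Nonempty D := hn.to_subtype
  have : IsDirectedOrder D := ⟨fun a b => by
    obtain ⟨c, hc, h1, h2⟩ := hd a.1 a.2 b.1 b.2
    exact ⟨⟨c, hc⟩, h1, h2⟩⟩
  refine ContinuousLinearMap.ext fun y => ext_inner_left ℂ fun x => ?_
  refine tendsto_nhds_unique (tendsto_inner_of_isLUB hn hd hT x (A y)) ?_
  rw [ContinuousLinearMap.comp_apply, ← ContinuousLinearMap.adjoint_inner_left]
  refine (tendsto_inner_of_isLUB hn hd hT _ y).congr fun S => ?_
  rw [ContinuousLinearMap.adjoint_inner_left]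
  exact congrArg (fun B : H →L[ℂ] H => ⟪x, B y⟫_ℂ) (hA S.1 S.2).symm

/-- Vector functionals are normal. -/
theorem scottContinuous_inner (x : H) : ScottContinuous fun T : H →L[ℂ] H => ⟪x, T x⟫_ℂ := by
  intro D hn hd T hT
  have : Nonempty D := hn.to_subtype
  have : IsDirectedOrder D := ⟨fun a b => by
    obtain ⟨c, hc, h1, h2⟩ := hd a.1 a.2 b.1 b.2
    exact ⟨⟨c, hc⟩, h1, h2⟩⟩
  have h1 := isLUB_of_tendsto_atTop (β := D) (f := fun S : D => ⟪x, S.1 x⟫_ℂ)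
    (fun S S' h => opLe_iff_inner.mp h x) (tendsto_inner_of_isLUB hn hd hT x x)
  rwa [Set.image_eq_range]

variable {G : Type*} [NormedAddCommGroup G] [InnerProductSpace ℂ G] [CompleteSpace G]

theorem scottContinuous_conj (A : H →L[ℂ] G) :
    ScottContinuous fun T : G →L[ℂ] G => ContinuousLinearMap.adjoint A ∘L T ∘L A :=
  scottContinuous_of_forall_inner fun x => by
    simpa only [ContinuousLinearMap.comp_apply, ContinuousLinearMap.adjoint_inner_right]
      using scottContinuous_inner (A x)

end OperatorOrder

/-! ### The amplification of adjointable operators: positivity and normality. -/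

section Amplification

variable {M : Type v} [CStarAlgebra M] [PartialOrder M] [StarOrderedRing M] {E : Type u}
  [NormedAddCommGroup E] [NormedSpace ℂ E] [Module Mᵐᵒᵖ E] [HilbertModule M E]

namespace Adjointable

theorem nonneg_iff {X : Adjointable M E} : 0 ≤ X ↔ ∀ x, 0 ≤ ip M x (X.1 x) := by
  change (∀ x, 0 ≤ ip M x ((X - 0).1 x)) ↔ _
  rw [sub_zero]

theorem le_iff {X Y : Adjointable M E} : X ≤ Y ↔ ∀ x, ip M x (X.1 x) ≤ ip M x (Y.1 x) := by
  change (∀ x, 0 ≤ ip M x (Y.1 x - X.1 x)) ↔ _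
  simp only [ip_sub_right, sub_nonneg]

theorem star_eq_of_nonneg {X : Adjointable M E} (hX : 0 ≤ X) : star X = X := by
  refine sub_eq_zero.mp (Subtype.ext (eq_zero_of_quadratic M _ fun x => ?_))
  change ip M x ((star X).1 x - X.1 x) = 0
  rw [ip_sub_right, ← ip_left, ← star_ip, (nonneg_iff.mp hX x).isSelfAdjoint.star_eq, sub_self]

/-- For `X ≥ 0` the matrix `(⟨ξᵢ, X ξⱼ⟩)` is of the form `D⋆ D`. -/
theorem exists_gram {X : Adjointable M E} (hX : 0 ≤ X) {n : ℕ} (ξ : Fin n → E) :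
    ∃ D : Fin n → Fin n → M, ∀ i j, ip M (ξ i) (X.1 (ξ j)) = ∑ k, star (D k i) * D k j := by
  let G : CStarMatrix (Fin n) (Fin n) M := CStarMatrix.ofMatrix fun i j => ip M (ξ i) (X.1 (ξ j))
  have hGa : ∀ i j, G i j = ip M (ξ i) (X.1 (ξ j)) := fun i j => rfl
  have hG : IsSelfAdjoint G := by
    ext i j
    rw [CStarMatrix.star_apply, hGa, hGa, star_ip, ip_left, star_eq_of_nonneg hX]
  obtain ⟨N, C, h1, h2⟩ := exists_negPart G hG
  have hC : C = 0 := by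
    ext k i
    -- The diagonal entries of $N^*GN=-C^*C$ have the form $\langle\zeta,X\zeta\rangle\ge0$ with
    -- $\zeta=\sum_k\xi_kN_{ki}$. So the sums of squares on the diagonal of $C^*C$ vanish, and with
    -- them all entries of $C$.
    have hd : (star N * G * N) i i = ip M (∑ k, MulOpposite.op (N k i) • ξ k)
        (X.1 (∑ k, MulOpposite.op (N k i) • ξ k)) := by
      simp only [CStarMatrix.mul_apply, CStarMatrix.star_apply, map_sum, map_rsmul, ip_sum_left,
        ip_sum_right, ip_rsmul_left, ip_rsmul_right, hGa, Finset.sum_mul, mul_assoc]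
    have hc : (star C * C) i i = ∑ k, star (C k i) * C k i := by
      simp only [CStarMatrix.mul_apply, CStarMatrix.star_apply]
    have h3 : 0 ≤ -∑ k, star (C k i) * C k i := by
      rw [← hc, ← CStarMatrix.neg_apply, ← h1, hd]
      exact nonneg_iff.mp hX _
    have h4 : ∀ k ∈ Finset.univ, 0 ≤ star (C k i) * C k i := fun k _ => star_mul_self_nonneg _
    have h5 : ∑ k, star (C k i) * C k i = 0 :=
      le_antisymm (neg_nonneg.mp h3) (Finset.sum_nonneg h4)
    have h6 := (Finset.sum_eq_zero_iff_of_nonneg h4).mp h5 k (Finset.mem_univ k)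
    simpa using (CStarRing.star_mul_self_eq_zero_iff _).mp h6
  obtain ⟨D, hD⟩ := h2 hC
  refine ⟨fun i j => D i j, fun i j => ?_⟩
  rw [← hGa, hD]
  simp only [CStarMatrix.mul_apply, CStarMatrix.star_apply]

end Adjointable

variable {R : Rep.{v, w} M}

theorem PreTensor.exists_eq_sum (x : PreTensor M E R) :
    ∃ (n : ℕ) (ξ : Fin n → E) (h : Fin n → R.space), x = ∑ i, PreTensor.tmul M (ξ i) (h i) := by
  induction x using PreTensor.induction with
  | zero => exact ⟨0, Fin.elim0, Fin.elim0, by simp⟩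
  | tmul ξ h => exact ⟨1, fun _ => ξ, fun _ => h, by simp⟩
  | add x y hx hy =>
    obtain ⟨n, ξ, h, rfl⟩ := hx
    obtain ⟨m, ζ, k, rfl⟩ := hy
    exact ⟨n + m, Fin.append ξ ζ, Fin.append h k, by simp [Fin.sum_univ_add]⟩

namespace Tensor

theorem amp_tmul (X : Adjointable M E) (ξ : E) (h : R.space) :
    amp R X (tmul M ξ h) = tmul M (X.1 ξ) h := map_tmul X (Intertwiner.id R) ξ h

theorem inner_tmul_amp (X : Adjointable M E) (ξ : E) (h : R.space) :
    ⟪tmul M ξ h, amp R X (tmul M ξ h)⟫_ℂ = ⟪h, R.act (ip M ξ (X.1 ξ)) h⟫_ℂ := by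
  rw [amp_tmul, inner_tmul]

/-- On a finite sum of simple tensors the factorization $(\langle\xi_i,X\xi_j\rangle)=D^*D$ turns
the quadratic form into a sum of squared norms; density does the rest. -/
theorem amp_nonneg {X : Adjointable M E} (hX : 0 ≤ X) : 0 ≤ amp R X := by
  rw [opNonneg_iff_inner]
  intro x
  induction x using UniformSpace.Completion.induction_on with
  | hp => exact isClosed_le (by fun_prop) (by fun_prop)
  | ih x =>
    obtain ⟨n, ξ, h, rfl⟩ := PreTensor.exists_eq_sum x
    have hsum : ((∑ i, PreTensor.tmul M (ξ i) (h i) : PreTensor M E R) : Tensor M E R)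
        = ∑ i, tmul M (ξ i) (h i) := by
      exact map_sum (UniformSpace.Completion.toComplL (𝕜 := ℂ) (E := PreTensor M E R)) _ _
    obtain ⟨D, hD⟩ := Adjointable.exists_gram hX ξ
    have key : ⟪∑ i, tmul M (R := R) (ξ i) (h i), amp R X (∑ i, tmul M (ξ i) (h i))⟫_ℂ
        = ∑ k, ⟪∑ i, R.act (D k i) (h i), ∑ j, R.act (D k j) (h j)⟫_ℂ := by
      simp only [map_sum, sum_inner, inner_sum, amp_tmul, inner_tmul, hD, map_mul, map_star,
        ContinuousLinearMap.star_eq_adjoint, sum_apply, _root_.mul_apply_eq_comp,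
        ContinuousLinearMap.adjoint_inner_right]
      rw [Finset.sum_comm_cycle]
    rw [hsum, key]
    refine Finset.sum_nonneg fun k _ => ?_
    rw [inner_self_eq_norm_sq_to_K]
    positivity

theorem amp_mono : Monotone (amp R : Adjointable M E → _) := fun X Y h => by
  have h1 : (0 : Adjointable M E) ≤ Y - X :=
    Adjointable.nonneg_iff.mpr h
  have := amp_nonneg (R := R) h1
  rw [map_sub, ContinuousLinearMap.nonneg_iff_isPositive] at this
  exact this

/-- `X ↦ X ⊗ I_H` is normal as soon as `σ` and all `X ↦ ⟨x, X x⟩` are. -/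
theorem scottContinuous_amp (hR : ScottContinuous R.act)
    (hE : ∀ ξ : E, ScottContinuous fun X : Adjointable M E => ip M ξ (X.1 ξ)) :
    ScottContinuous (amp R : Adjointable M E → _) := by
  intro D hn hd X hX
  have hb : amp R X ∈ upperBounds (amp R '' D) := amp_mono.mem_upperBounds_image hX.1
  have hd' : DirectedOn (· ≤ ·) (amp R '' D) := hd.mono_comp amp_mono
  -- The amplified set has a supremum `Y` in the bounded operators, and `Y ≤ amp R X` is automatic.
  -- What is left is that the positive excess `amp R X - Y` vanishes.
  obtain ⟨Y, hY, -⟩ := exists_isLUB_tendsto_inner (hn.image _) hd' ⟨_, hb⟩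
  suffices h : amp R X = Y by rwa [h]
  have hle : Y ≤ amp R X := hY.2 hb
  have hpos : (amp R X - Y).IsPositive := hle
  obtain ⟨B, hB⟩ := CStarAlgebra.nonneg_iff_eq_star_mul_self.mp
    ((ContinuousLinearMap.nonneg_iff_isPositive _).mpr hpos)
  refine sub_eq_zero.mp (ext fun ξ h => ?_)
  have h1 : ⟪tmul M ξ h, (amp R X - Y) (tmul M ξ h)⟫_ℂ = 0 := by
    -- At $\xi\otimes h$ both operators give the supremum of the same numbers: `Y` because vector
    -- functionals are normal, `amp R X` because $Z\mapsto\langle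
    -- h,\sigma(\langle\xi,Z\xi\rangle)h\rangle$ is a composite of normal maps.
    have h2 := scottContinuous_inner (tmul M ξ h) (hn.image _) hd' hY
    have h3 := ((hE ξ).comp hR |>.comp (scottContinuous_inner h)) hn hd hX
    rw [Set.image_image] at h2
    simp only [Function.comp_def, ← inner_tmul_amp] at h3
    rw [sub_apply, inner_sub_right, sub_eq_zero]
    exact h3.unique h2
  -- With the excess written as $B^*B$, a zero diagonal coefficient means that $B$ kills $\xi\otimes
  -- h$. Simple tensors thus suffice, without off-diagonal coefficients.
  rw [hB] at h1 ⊢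
  rw [ContinuousLinearMap.star_eq_adjoint, _root_.mul_apply_eq_comp,
    ContinuousLinearMap.adjoint_inner_right, inner_self_eq_zero] at h1
  rw [_root_.mul_apply_eq_comp, h1, map_zero, zero_apply]

end Tensor

end Amplification

/-! ### Normality of the matrix coefficients on the Fock module. -/

section FockNormal

variable {M : Type v} [CStarAlgebra M] [PartialOrder M] [StarOrderedRing M]

/-- A faithful representation reflects positivity. -/
theorem Rep.nonneg_of_act_nonneg (R : Rep.{v, w} M) (hR : Function.Injective R.act) {a : M}
    (ha : 0 ≤ R.act a) : 0 ≤ a := by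
  have hsa : IsSelfAdjoint a := hR (by rw [map_star]; exact ha.isSelfAdjoint.star_eq)
  obtain ⟨P, C, h1, h2⟩ := exists_negPart _ hsa
  have hC : R.act C = 0 := by
    have h4 : 0 ≤ star (R.act P) * R.act a * R.act P := star_left_conjugate_nonneg ha _
    rw [← map_star, ← map_mul, ← map_mul, h1, map_neg, map_mul, map_star, neg_nonneg] at h4
    exact (CStarRing.star_mul_self_eq_zero_iff _).mp (le_antisymm h4 (star_mul_self_nonneg _))
  obtain ⟨D, hD⟩ := h2 (hR (by rw [hC, map_zero]))
  rw [hD]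
  exact star_mul_self_nonneg D

theorem Rep.le_of_act_le (R : Rep.{v, w} M) (hR : Function.Injective R.act) {a b : M}
    (h : ∀ k, ⟪k, R.act a k⟫_ℂ ≤ ⟪k, R.act b k⟫_ℂ) : a ≤ b := by
  rw [← sub_nonneg]
  refine R.nonneg_of_act_nonneg hR (opNonneg_iff_inner.mpr fun k => ?_)
  rw [map_sub, sub_apply, inner_sub_right, sub_nonneg]
  exact h k

variable {K : Type u} [NormedAddCommGroup K] [InnerProductSpace ℂ K] [CompleteSpace K]
  {N : VonNeumannAlgebra K} {π : M ≃⋆ₐ[ℂ] N.toStarSubalgebra} {E : Type u}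
  [NormedAddCommGroup E] [NormedSpace ℂ E] [Module Mᵐᵒᵖ E] [HilbertModule M E]
  {φ : M →⋆ₙₐ[ℂ] Adjointable M E}

namespace Fock

variable (π φ) in
/-- The map `T ⊗ k ↦ T k` on the algebraic tensor product. -/
def evalLin : PreTensor M (Fock π φ) (Rep.ofVN π) →ₗ[ℂ] ((Rep.ofVN π).fock φ).space :=
  TensorProduct.lift <| LinearMap.mk₂ ℂ
    (fun (T : Fock π φ) (k : (Rep.ofVN π).space) => op T k)
    (fun S T k => by rw [map_add]; rfl)
    (fun c T k => by rw [map_smul]; rfl)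
    (fun T k l => map_add _ _ _)
    (fun c T k => map_smul _ _ _)

theorem evalLin_tmul (T : Fock π φ) (k : (Rep.ofVN π).space) :
    evalLin π φ (PreTensor.tmul M T k) = op T k := rfl

theorem inner_evalLin (x y : PreTensor M (Fock π φ) (Rep.ofVN π)) :
    ⟪evalLin π φ x, evalLin π φ y⟫_ℂ = ⟪x, y⟫_ℂ := by
  induction x using PreTensor.induction with
  | zero => simp
  | add x x' hx hx' => rw [map_add, inner_add_left, inner_add_left, hx, hx']
  | tmul S k =>
    induction y using PreTensor.induction with
    | zero => simp
    | add y y' hy hy' => rw [map_add, inner_add_right, inner_add_right, hy, hy']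
    | tmul T l =>
      rw [evalLin_tmul, evalLin_tmul, PreTensor.inner_tmul, act_ip,
        ContinuousLinearMap.comp_apply, ContinuousLinearMap.adjoint_inner_right]

theorem norm_evalLin (x : PreTensor M (Fock π φ) (Rep.ofVN π)) : ‖evalLin π φ x‖ = ‖x‖ := by
  rw [@norm_eq_sqrt_re_inner ℂ, @norm_eq_sqrt_re_inner ℂ, inner_evalLin]

variable (π φ) in
/-- The canonical isometry `𝓕(E) ⊗_π K → ⊕ₙ E^{⊗ n} ⊗_π K`, `T ⊗ k ↦ T k`. -/
def eval : Tensor M (Fock π φ) (Rep.ofVN π) →L[ℂ] ((Rep.ofVN π).fock φ).space :=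
  ((evalLin π φ).mkContinuous 1 fun x => by
    rw [one_mul]
    exact (norm_evalLin x).le).fromCompletion

theorem eval_tmul (T : Fock π φ) (k : (Rep.ofVN π).space) :
    eval π φ (Tensor.tmul M T k) = op T k := by
  rw [eval, Tensor.tmul_apply, ContinuousLinearMap.fromCompletion_apply_coe]
  rfl

/-- The adjoint of the isometry `eval` inverts it on its range. Only vectors of the form $Tk$ are
needed later, so surjectivity of `eval` plays no role. -/
theorem adjoint_eval_op (T : Fock π φ) (k : (Rep.ofVN π).space) :
    ContinuousLinearMap.adjoint (eval π φ) (op T k) = Tensor.tmul M T k := by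
  refine Tensor.ext_inner fun S l => ?_
  rw [ContinuousLinearMap.adjoint_inner_right, eval_tmul, Tensor.inner_tmul, act_ip,
    ContinuousLinearMap.comp_apply, ContinuousLinearMap.adjoint_inner_right]

theorem eval_map (b : Intertwiner (Rep.ofVN π) (Rep.ofVN π)) :
    eval π φ ∘L Tensor.map 1 b = (Intertwiner.fock φ b).1 ∘L eval π φ :=
  Tensor.ext fun T k => by
    rw [ContinuousLinearMap.comp_apply, ContinuousLinearMap.comp_apply, Tensor.map_tmul, eval_tmul,
      eval_tmul]
    exact congrArg (fun A => A k) (op_comp T b)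

theorem adjoint_eval_fock (b : Intertwiner (Rep.ofVN π) (Rep.ofVN π)) :
    ContinuousLinearMap.adjoint (eval π φ) ∘L (Intertwiner.fock φ b).1
      = Tensor.map 1 b ∘L ContinuousLinearMap.adjoint (eval π φ) := by
  have h := congrArg ContinuousLinearMap.adjoint (eval_map (π := π) (φ := φ) (Intertwiner.adj b))
  rw [ContinuousLinearMap.adjoint_comp, ContinuousLinearMap.adjoint_comp, Intertwiner.fock_adj,
    ContinuousLinearMap.adjoint_adjoint, Tensor.adjoint_map, Adjointable.star_one] at h
  have hb : Intertwiner.adj (Intertwiner.adj b) = b :=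
    Subtype.ext (ContinuousLinearMap.adjoint_adjoint _)
  rw [hb] at h
  exact h.symm

/-- An operator on `𝓕(E) ⊗_π K` commuting with all `I ⊗ b`, `b ∈ π(M)'`, comes from an adjointable
operator on `𝓕(E)`. -/
def ofTensor (Y : Tensor M (Fock π φ) (Rep.ofVN π) →L[ℂ] Tensor M (Fock π φ) (Rep.ofVN π))
    (hY : ∀ b : Intertwiner (Rep.ofVN π) (Rep.ofVN π),
      Y ∘L Tensor.map 1 b = Tensor.map 1 b ∘L Y) : Adjointable M (Fock π φ) :=
  leftMulAdj (eval π φ ∘L Y ∘L ContinuousLinearMap.adjoint (eval π φ)) fun b => by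
    rw [ContinuousLinearMap.comp_assoc, ContinuousLinearMap.comp_assoc, adjoint_eval_fock,
      ← ContinuousLinearMap.comp_assoc Y, hY, ContinuousLinearMap.comp_assoc,
      ← ContinuousLinearMap.comp_assoc, eval_map, ContinuousLinearMap.comp_assoc]

/-- Since $\pi$ is faithful, this lets inequalities between module-valued forms on the Fock space be
checked as operator inequalities on $\mathcal F(E)\otimes_\pi K$. -/
theorem inner_act_ip_ofTensor
    (Y : Tensor M (Fock π φ) (Rep.ofVN π) →L[ℂ] Tensor M (Fock π φ) (Rep.ofVN π)) (hY)
    (T : Fock π φ) (k : (Rep.ofVN π).space) :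
    ⟪k, (Rep.ofVN π).act (ip M T ((ofTensor Y hY).1 T)) k⟫_ℂ
      = ⟪Tensor.tmul M T k, Y (Tensor.tmul M T k)⟫_ℂ := by
  rw [act_ip, ofTensor, op_leftMulAdj, ContinuousLinearMap.comp_apply,
    ContinuousLinearMap.adjoint_inner_right]
  change ⟪op T k, eval π φ (Y (ContinuousLinearMap.adjoint (eval π φ) (op T k)))⟫_ℂ = _
  rw [← ContinuousLinearMap.adjoint_inner_left, adjoint_eval_op]

theorem amp_comp_map_one (X : Adjointable M (Fock π φ))
    (b : Intertwiner (Rep.ofVN π) (Rep.ofVN π)) :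
    Tensor.amp (Rep.ofVN π) X ∘L Tensor.map 1 b
      = Tensor.map 1 b ∘L Tensor.amp (Rep.ofVN π) X :=
  Tensor.ext fun S k => by
    rw [ContinuousLinearMap.comp_apply, ContinuousLinearMap.comp_apply, Tensor.map_tmul,
      Tensor.amp_tmul, Tensor.amp_tmul, Tensor.map_tmul]
    rfl

theorem inner_le_inner_of_le {R : Rep.{v, w} M} {a b : M} (h : a ≤ b) (k : R.space) :
    ⟪k, R.act a k⟫_ℂ ≤ ⟪k, R.act b k⟫_ℂ :=
  opLe_iff_inner.mp (OrderHomClass.mono R.act h) k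

/-- The supremum of a directed set in `𝓛(𝓕(E))` acts as the supremum of the operators on
`𝓕(E) ⊗_π K`. -/
theorem isLUB_ofTensor {D : Set (Adjointable M (Fock π φ))}
    {Y : Tensor M (Fock π φ) (Rep.ofVN π) →L[ℂ] Tensor M (Fock π φ) (Rep.ofVN π)} (hY)
    (h : IsLUB (Tensor.amp (Rep.ofVN π) '' D) Y) : IsLUB D (ofTensor Y hY) := by
  have hinj := Rep.ofVN_injective π
  refine ⟨fun X hX => Adjointable.le_iff.mpr fun S => Rep.le_of_act_le _ hinj fun k => ?_,
    fun U hU => Adjointable.le_iff.mpr fun S => Rep.le_of_act_le _ hinj fun k => ?_⟩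
  · rw [inner_act_ip_ofTensor, ← Tensor.inner_tmul_amp]
    exact opLe_iff_inner.mp (h.1 ⟨X, hX, rfl⟩) _
  · rw [inner_act_ip_ofTensor, ← Tensor.inner_tmul_amp]
    exact opLe_iff_inner.mp (h.2 (Tensor.amp_mono.mem_upperBounds_image hU)) _

/-- Suprema of directed sets in `𝓛(𝓕(E))` are weak limits. -/
theorem scottContinuous_ip (T : Fock π φ) :
    ScottContinuous fun X : Adjointable M (Fock π φ) => ip M T (X.1 T) := by
  intro D hn hd X hX
  have hb : Tensor.amp (Rep.ofVN π) X ∈ upperBounds (Tensor.amp (Rep.ofVN π) '' D) :=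
    Tensor.amp_mono.mem_upperBounds_image hX.1
  have hd' : DirectedOn (· ≤ ·) (Tensor.amp (Rep.ofVN π) '' D) := hd.mono_comp Tensor.amp_mono
  obtain ⟨Y, hY, -⟩ := exists_isLUB_tendsto_inner (hn.image _) hd' ⟨_, hb⟩
  -- Each amplified operator commutes with all $I\otimes b$, so the supremum does; this is what
  -- makes it come from an adjointable operator.
  have hcomm : ∀ b : Intertwiner (Rep.ofVN π) (Rep.ofVN π),
      Y ∘L Tensor.map 1 b = Tensor.map 1 b ∘L Y := fun b =>
    comm_of_isLUB (hn.image _) hd' hY (by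
      rintro _ ⟨Z, -, rfl⟩
      exact amp_comp_map_one Z b)
  have hlub := isLUB_ofTensor hcomm hY
  -- Suprema are unique, so `X` may be replaced by the operator built from `Y`, whose coefficients
  -- are known.
  rw [hX.unique hlub]
  refine ⟨?_, fun a ha => Rep.le_of_act_le _ (Rep.ofVN_injective π) fun k => ?_⟩
  · rintro _ ⟨Z, hZ, rfl⟩
    exact Adjointable.le_iff.mp (hlub.1 hZ) T
  · rw [inner_act_ip_ofTensor]
    -- In $\pi$, the coefficient of `Y` at $T\otimes k$ is the supremum of those of the amplified
    -- `Z`, and each of these is dominated through the upper bound `a`.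
    refine (scottContinuous_inner (Tensor.tmul M T k) (hn.image _) hd' hY).2 ?_
    rintro _ ⟨_, ⟨Z, hZ, rfl⟩, rfl⟩
    change ⟪Tensor.tmul M T k, Tensor.amp (Rep.ofVN π) Z (Tensor.tmul M T k)⟫_ℂ ≤ _
    rw [Tensor.inner_tmul_amp]
    exact inner_le_inner_of_le (ha ⟨Z, hZ, rfl⟩) k

theorem scottContinuous_amp {R : Rep.{v, w} M} (hR : ScottContinuous R.act) :
    ScottContinuous (Tensor.amp R : Adjointable M (Fock π φ) → _) :=
  Tensor.scottContinuous_amp hR scottContinuous_ip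

end Fock

end FockNormal

section PoissonKernel

variable {M : Type v} [CStarAlgebra M] [PartialOrder M] [StarOrderedRing M] {E : Type u}
  [NormedAddCommGroup E] [NormedSpace ℂ E] [Module Mᵐᵒᵖ E] [HilbertModule M E]
  {φ : M →⋆ₙₐ[ℂ] Adjointable M E}

/-! ### Calculus of the operators $I_E\otimes S$ and $h\mapsto\xi\otimes h$. -/

section Induced

variable (φ) (R : Rep.{v, w} M) {R' : Rep.{v, w'} M} {R'' : Rep.{v, w''} M}

/-- `Tensor.tmul` with values in the space of the induced representation. -/
def Rep.tmul (ξ : E) : R.space →L[ℂ] (R.induced φ).space := Tensor.tmul M ξ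

/-- `Tensor.amp` on the space of the induced representation. -/
def Rep.amp : Adjointable M E →⋆ₙₐ[ℂ] ((R.induced φ).space →L[ℂ] (R.induced φ).space) :=
  Tensor.amp R

theorem Rep.amp_apply (a : M) : R.amp φ (φ a) = (R.induced φ).act a := rfl

variable {R}

theorem Rep.induced_ext {V : Type*} [NormedAddCommGroup V] [NormedSpace ℂ V]
    {T T' : (R.induced φ).space →L[ℂ] V}
    (h : ∀ ξ, T ∘L R.tmul φ ξ = T' ∘L R.tmul φ ξ) : T = T' :=
  Tensor.ext fun ξ k => congrArg (fun A => A k) (h ξ)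

/-- Simple tensors are total, so a vector is determined by applying all the adjoints of
$h\mapsto\xi\otimes h$ to it. The identities for the adjoint of the shift below are tested this way.
-/
theorem Rep.induced_ext_adjoint {V : Type*} [NormedAddCommGroup V] [InnerProductSpace ℂ V]
    [CompleteSpace V] {T T' : V →L[ℂ] (R.induced φ).space}
    (h : ∀ ξ, ContinuousLinearMap.adjoint (R.tmul φ ξ) ∘L T
      = ContinuousLinearMap.adjoint (R.tmul φ ξ) ∘L T') : T = T' := by
  apply (ContinuousLinearMap.adjoint (𝕜 := ℂ)).injective
  refine Rep.induced_ext φ fun ξ => ?_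
  have := congrArg ContinuousLinearMap.adjoint (h ξ)
  simpa only [ContinuousLinearMap.adjoint_comp, ContinuousLinearMap.adjoint_adjoint] using this

variable (R)

theorem Rep.adjoint_tmul_comp_tmul (ξ ζ : E) :
    ContinuousLinearMap.adjoint (R.tmul φ ξ) ∘L R.tmul φ ζ = R.act (ip M ξ ζ) := by
  ext1 h
  refine ext_inner_left ℂ fun k => ?_
  rw [ContinuousLinearMap.comp_apply, ContinuousLinearMap.adjoint_inner_right]
  exact Tensor.inner_tmul ξ ζ k h

theorem Rep.amp_comp_tmul (X : Adjointable M E) (ξ : E) :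
    R.amp φ X ∘L R.tmul φ ξ = R.tmul φ (X.1 ξ) := by
  ext1 h
  exact Tensor.amp_tmul X ξ h

theorem Rep.tmul_zero : R.tmul φ 0 = 0 := by
  refine Rep.induced_ext_adjoint φ fun ξ => ?_
  rw [Rep.adjoint_tmul_comp_tmul, ip_zero_right, map_zero, ContinuousLinearMap.comp_zero]

variable {R}

theorem Intertwiner.induced_comp_tmul (S : Intertwiner R R') (ξ : E) :
    (Intertwiner.induced φ S).1 ∘L R.tmul φ ξ = R'.tmul φ ξ ∘L S.1 := by
  ext1 h
  exact Tensor.map_tmul 1 S ξ h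

theorem Intertwiner.induced_comp (S : Intertwiner R' R'') (T : Intertwiner R R') :
    Intertwiner.induced φ (Intertwiner.comp S T) = Intertwiner.comp (Intertwiner.induced φ S) (Intertwiner.induced φ T) :=
  Subtype.ext <| Rep.induced_ext φ fun ξ => by
    change _ = ((Intertwiner.induced φ S).1 ∘L (Intertwiner.induced φ T).1) ∘L _
    rw [Intertwiner.induced_comp_tmul, ContinuousLinearMap.comp_assoc,
      Intertwiner.induced_comp_tmul, ← ContinuousLinearMap.comp_assoc,
      Intertwiner.induced_comp_tmul]
    rfl

theorem Intertwiner.induced_adj (S : Intertwiner R R') :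
    Intertwiner.induced φ (Intertwiner.adj S) = Intertwiner.adj (Intertwiner.induced φ S) :=
  Subtype.ext <| by
    change Tensor.map 1 _ = ContinuousLinearMap.adjoint (Tensor.map 1 S)
    rw [Tensor.adjoint_map, Adjointable.star_one]

theorem Intertwiner.adjoint_tmul_comp_induced (S : Intertwiner R R') (ξ : E) :
    ContinuousLinearMap.adjoint (R'.tmul φ ξ) ∘L (Intertwiner.induced φ S).1
      = S.1 ∘L ContinuousLinearMap.adjoint (R.tmul φ ξ) := by
  have h := congrArg ContinuousLinearMap.adjoint (Intertwiner.induced_comp_tmul φ (adj S) ξ)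
  rw [Intertwiner.induced_adj, ContinuousLinearMap.adjoint_comp,
    ContinuousLinearMap.adjoint_comp] at h
  have h1 : ContinuousLinearMap.adjoint (adj (Intertwiner.induced φ S)).1 = (Intertwiner.induced φ S).1 :=
    ContinuousLinearMap.adjoint_adjoint _
  have h2 : ContinuousLinearMap.adjoint (adj S).1 = S.1 :=
    ContinuousLinearMap.adjoint_adjoint _
  rwa [h1, h2] at h

theorem Intertwiner.induced_sub (S T : Intertwiner R R') :
    Intertwiner.induced φ (S - T) = Intertwiner.induced φ S - Intertwiner.induced φ T :=
  Subtype.ext <| Rep.induced_ext φ fun ξ => by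
    change _ = ((Intertwiner.induced φ S).1 - (Intertwiner.induced φ T).1) ∘L _
    rw [Intertwiner.induced_comp_tmul, ContinuousLinearMap.sub_comp,
      Intertwiner.induced_comp_tmul, Intertwiner.induced_comp_tmul,
      ← ContinuousLinearMap.comp_sub]
    rfl

theorem Intertwiner.induced_add (S T : Intertwiner R R') :
    Intertwiner.induced φ (S + T) = Intertwiner.induced φ S + Intertwiner.induced φ T :=
  Subtype.ext <| Rep.induced_ext φ fun ξ => by
    change _ = ((Intertwiner.induced φ S).1 + (Intertwiner.induced φ T).1) ∘L _
    rw [Intertwiner.induced_comp_tmul, ContinuousLinearMap.add_comp,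
      Intertwiner.induced_comp_tmul, Intertwiner.induced_comp_tmul,
      ← ContinuousLinearMap.comp_add]
    rfl

theorem Intertwiner.induced_smul (c : ℂ) (S : Intertwiner R R') :
    Intertwiner.induced φ (c • S) = c • Intertwiner.induced φ S :=
  Subtype.ext <| Rep.induced_ext φ fun ξ => by
    change _ = (c • (Intertwiner.induced φ S).1) ∘L _
    rw [Intertwiner.induced_comp_tmul, ContinuousLinearMap.smul_comp,
      Intertwiner.induced_comp_tmul, ← ContinuousLinearMap.comp_smul]
    rfl

theorem Intertwiner.induced_id : Intertwiner.induced φ (Intertwiner.id R) = Intertwiner.id (R.induced φ) :=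
  Subtype.ext <| Rep.induced_ext φ fun ξ => by
    rw [Intertwiner.induced_comp_tmul]
    rfl

theorem Intertwiner.norm_induced_le (S : Intertwiner R R') : ‖(Intertwiner.induced φ S).1‖ ≤ ‖S.1‖ :=
  Tensor.norm_map_one_le S

/-- $S\mapsto I_E\otimes S$ is linear and contractive, hence passes through norm convergent series.
It is applied to the Cauchy kernel. -/
theorem Intertwiner.hasSum_induced {ι : Type*} {S : ι → Intertwiner R R'} {T : Intertwiner R R'}
    (h : HasSum (fun i => (S i).1) T.1) :
    HasSum (fun i => (Intertwiner.induced φ (S i)).1) (Intertwiner.induced φ T).1 := by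
  -- The map $S\mapsto I_E\otimes S$ exists only on intertwiners, so convergence is first moved to
  -- that subspace.
  have h1 : HasSum S T :=
    (Topology.IsInducing.subtypeVal.hasSum_iff (g := (Intertwiner R R').subtype) S T).mp h
  let L : Intertwiner R R' →L[ℂ] ((R.induced φ).space →L[ℂ] (R'.induced φ).space) :=
    LinearMap.mkContinuous
      { toFun := fun S => (Intertwiner.induced φ S).1
        map_add' := fun S T => congrArg Subtype.val (Intertwiner.induced_add φ S T)
        map_smul' := fun c S => congrArg Subtype.val (Intertwiner.induced_smul φ c S) } 1
      fun S => by
        rw [one_mul]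
        exact Intertwiner.norm_induced_le φ S
  exact h1.mapL L

end Induced

/-! ### Vacuum and shift as isometries with orthogonal ranges; the Cauchy kernel recursion. -/

variable {K : Type u} [NormedAddCommGroup K] [InnerProductSpace ℂ K] [CompleteSpace K]
  {N : VonNeumannAlgebra K} (π : M ≃⋆ₐ[ℂ] N.toStarSubalgebra)
  {R : Rep.{v, w} M} {R' : Rep.{v, w'} M}

variable (φ)

theorem inner_zeroth (R : Rep.{v, u} M) (k : R.space) (f : FockSum φ R) :
    ⟪f, zeroth φ R k⟫_ℂ = ⟪f 0, (k : (level φ R 0).space)⟫_ℂ := by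
  rw [lp.inner_eq_tsum, tsum_eq_single 0]
  · rfl
  · rintro (_ | n) hn
    · exact absurd rfl hn
    · exact inner_zero_right _

/-- The range of $T_\xi$ has zero component in degree $0$, where the vacuum lives. -/
theorem Fock.star_creation_vacuum (ξ : E) :
    (star (Fock.creation π φ ξ)).1 (Fock.vacuum π φ) = 0 := by
  refine ip_ext M fun S => Rep.ofVN_injective π ?_
  rw [← Adjointable.ip_left, ip_zero_right, map_zero, Fock.act_ip, Fock.creation,
    Fock.op_leftMulAdj]
  ext1 k
  refine ext_inner_left ℂ fun l => ?_
  rw [ContinuousLinearMap.comp_apply, ContinuousLinearMap.adjoint_inner_right]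
  refine (inner_zeroth φ (Rep.ofVN π) k (shift φ (Rep.ofVN π) ξ (Fock.op S l))).trans ?_
  exact (inner_zero_left _).trans (inner_zero_right _).symm

theorem Fock.ip_vacuum : ip M (Fock.vacuum π φ) (Fock.vacuum π φ) = 1 := by
  refine Rep.ofVN_injective π ?_
  rw [Fock.act_ip]
  ext1 k
  refine ext_inner_left ℂ fun l => ?_
  have h1 : (Rep.ofVN π).act 1 k = k := by
    have h : (Rep.ofVN π).act 1 = ContinuousLinearMap.id ℂ _ := congrArg Subtype.val (map_one π)
    rw [h]
    rfl
  rw [ContinuousLinearMap.comp_apply, ContinuousLinearMap.adjoint_inner_right, h1]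
  exact inner_zeroth φ (Rep.ofVN π) k (zeroth φ (Rep.ofVN π) l)

variable (R)

theorem shiftMap_comp_tmul (ξ : E) :
    (Intertwiner.shiftMap π φ R).1 ∘L (R.fockInduced π φ).tmul φ ξ
      = R.amp (Fock.leftAct π φ) (Fock.creation π φ ξ) := by
  ext1 y
  exact shiftMap_tmul π φ R ξ y

/-- By $T_\xi^*T_\zeta=\varphi_\infty(\langle\xi,\zeta\rangle)$, applying $T_\xi^*\otimes I$ after
the shift sends $\zeta\otimes y$ to $\langle\xi,\zeta\rangle y$, which is contraction against $\xi$.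
-/
theorem amp_star_creation_comp_shiftMap (ξ : E) :
    R.amp (Fock.leftAct π φ) (star (Fock.creation π φ ξ)) ∘L (Intertwiner.shiftMap π φ R).1
      = ContinuousLinearMap.adjoint ((R.fockInduced π φ).tmul φ ξ) :=
  Rep.induced_ext φ fun ζ => by
    rw [ContinuousLinearMap.comp_assoc, shiftMap_comp_tmul, Rep.adjoint_tmul_comp_tmul,
      ← Rep.amp_apply, ← Fock.star_creation_mul, map_mul]
    rfl

theorem vacuum_eq_tmul :
    (Intertwiner.vacuum π φ R).1 = R.tmul (Fock.leftAct π φ) (Fock.vacuum π φ) := rfl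

theorem amp_star_creation_comp_vacuum (ξ : E) :
    R.amp (Fock.leftAct π φ) (star (Fock.creation π φ ξ)) ∘L (Intertwiner.vacuum π φ R).1 = 0 := by
  rw [vacuum_eq_tmul, Rep.amp_comp_tmul, Fock.star_creation_vacuum, Rep.tmul_zero]

theorem adjoint_shiftMap_comp_shiftMap :
    ContinuousLinearMap.adjoint (Intertwiner.shiftMap π φ R).1 ∘L (Intertwiner.shiftMap π φ R).1
      = ContinuousLinearMap.id ℂ _ :=
  Rep.induced_ext_adjoint φ fun ξ => by
    rw [← ContinuousLinearMap.comp_assoc, ← ContinuousLinearMap.adjoint_comp, shiftMap_comp_tmul,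
      ← ContinuousLinearMap.star_eq_adjoint (R.amp _ _), ← map_star,
      amp_star_creation_comp_shiftMap, ContinuousLinearMap.comp_id]

theorem adjoint_shiftMap_comp_vacuum :
    ContinuousLinearMap.adjoint (Intertwiner.shiftMap π φ R).1 ∘L (Intertwiner.vacuum π φ R).1
      = 0 :=
  Rep.induced_ext_adjoint φ fun ξ => by
    rw [← ContinuousLinearMap.comp_assoc, ← ContinuousLinearMap.adjoint_comp, shiftMap_comp_tmul,
      ← ContinuousLinearMap.star_eq_adjoint (R.amp _ _), ← map_star,
      amp_star_creation_comp_vacuum, ContinuousLinearMap.comp_zero]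

theorem adjoint_vacuum_comp_shiftMap :
    ContinuousLinearMap.adjoint (Intertwiner.vacuum π φ R).1 ∘L (Intertwiner.shiftMap π φ R).1
      = 0 := by
  have h := congrArg ContinuousLinearMap.adjoint (adjoint_shiftMap_comp_vacuum φ π R)
  rwa [ContinuousLinearMap.adjoint_comp, ContinuousLinearMap.adjoint_adjoint, map_zero] at h

variable {R}

/-- The product is $\sigma(\langle1,1\rangle)=\sigma(1)$; this is where unitality of $\sigma$
enters. -/
theorem adjoint_vacuum_comp_vacuum (hR : R.act 1 = 1) :
    ContinuousLinearMap.adjoint (Intertwiner.vacuum π φ R).1 ∘L (Intertwiner.vacuum π φ R).1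
      = ContinuousLinearMap.id ℂ _ := by
  rw [vacuum_eq_tmul, Rep.adjoint_tmul_comp_tmul, Fock.ip_vacuum, hR]
  rfl

/-- `shiftMap` is natural in the representation. -/
theorem induced_comp_shiftMap (S : Intertwiner R R') :
    (Intertwiner.induced (Fock.leftAct π φ) S).1 ∘L (Intertwiner.shiftMap π φ R).1
      = (Intertwiner.shiftMap π φ R').1 ∘L (Intertwiner.induced φ (Intertwiner.induced (Fock.leftAct π φ) S)).1 :=
  Rep.induced_ext φ fun ξ => by
    rw [ContinuousLinearMap.comp_assoc, ContinuousLinearMap.comp_assoc, shiftMap_comp_tmul,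
      Intertwiner.induced_comp_tmul, ← ContinuousLinearMap.comp_assoc, shiftMap_comp_tmul]
    -- After testing on $\xi$, both sides are operators on $\mathcal F(E)\otimes_\sigma H$. On
    -- $T\otimes h$ each gives $T_\xi T\otimes Sh$, as $T_\xi$ and $S$ act on different factors.
    refine Rep.induced_ext _ fun T => ?_
    rw [ContinuousLinearMap.comp_assoc, ContinuousLinearMap.comp_assoc, Rep.amp_comp_tmul,
      Intertwiner.induced_comp_tmul, Intertwiner.induced_comp_tmul,
      ← ContinuousLinearMap.comp_assoc, Rep.amp_comp_tmul]

variable {φ}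

/-- The Cauchy kernel intertwines `σ` and `φ_∞(·) ⊗ I_H`. -/
def Intertwiner.cauchyKernel (η : Intertwiner R (R.induced φ)) (hη : ‖η‖ < 1) :
    Intertwiner R (R.fockInduced π φ) :=
  ⟨HardyPoisson.cauchyKernel π η, fun a => by
    have hs := (summable_genPower π η hη).hasSum
    have h1 := hs.mapL ((ContinuousLinearMap.compL ℂ _ _ _).flip (R.act a))
    have h2 := hs.mapL (ContinuousLinearMap.compL ℂ _ _ _ ((R.fockInduced π φ).act a))
    have h3 : (fun n => (genPower π η n).1 ∘L R.act a)
        = fun n => (R.fockInduced π φ).act a ∘L (genPower π η n).1 :=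
      funext fun n => (genPower π η n).2 a
    exact h1.unique (h3 ▸ h2)⟩

/-- `C(η) = η^{(0)} + (I_E ⊗ C(η)) η`. -/
theorem cauchyKernel_eq (η : Intertwiner R (R.induced φ)) (hη : ‖η‖ < 1) :
    (Intertwiner.cauchyKernel π η hη).1 = (Intertwiner.vacuum π φ R).1
      + (Intertwiner.shiftMap π φ R).1 ∘L (Intertwiner.induced φ (Intertwiner.cauchyKernel π η hη)).1
        ∘L η.1 := by
  have hs : HasSum (fun n => (genPower π η n).1) (Intertwiner.cauchyKernel π η hη).1 :=
    (summable_genPower π η hη).hasSum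
  -- The series without its term $n=0$ is $\sum_n\eta^{(n+1)}$. By the definition of the powers this
  -- is the image of the whole series under $A\mapsto S(I_E\otimes A)\eta$, $S$ the shift, and the
  -- two values of the sum are compared.
  have h1 := (hasSum_nat_add_iff' 1).mpr hs
  have h2 := ((Intertwiner.hasSum_induced φ hs).mapL
    ((ContinuousLinearMap.compL ℂ _ _ _).flip η.1)).mapL
    (ContinuousLinearMap.compL ℂ _ _ _ (Intertwiner.shiftMap π φ R).1)
  have h3 := h1.unique h2
  rw [Finset.sum_range_one] at h3
  exact sub_eq_iff_eq_add'.mp h3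

end PoissonKernel

/-! ### The Poisson kernel is an isometry and intertwines the creation operators. -/

section PoissonIsometry

variable {M : Type v} [CStarAlgebra M] [PartialOrder M] [StarOrderedRing M] {E : Type u}
  [NormedAddCommGroup E] [NormedSpace ℂ E] [Module Mᵐᵒᵖ E] [HilbertModule M E]
  {φ : M →⋆ₙₐ[ℂ] Adjointable M E}
  {K : Type u} [NormedAddCommGroup K] [InnerProductSpace ℂ K] [CompleteSpace K]
  {N : VonNeumannAlgebra K} (π : M ≃⋆ₐ[ℂ] N.toStarSubalgebra)
  {R : Rep.{v, w} M}

theorem adjoint_defect_comp_defect (η : Intertwiner R (R.induced φ)) (hη : ‖η‖ < 1) :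
    ContinuousLinearMap.adjoint (defect η).1 ∘L (defect η).1
      = ContinuousLinearMap.id ℂ _ - ContinuousLinearMap.adjoint η.1 ∘L η.1 := by
  -- `CFC.sqrt` squares back to its argument only when that is nonnegative; here $\eta^*\eta\le I$
  -- because $\|\eta\|<1$.
  have h0 : 0 ≤ 1 - ContinuousLinearMap.adjoint η.1 ∘L η.1 := by
    rw [opNonneg_iff_inner]
    intro x
    rw [sub_apply, inner_sub_right, ContinuousLinearMap.comp_apply,
      ContinuousLinearMap.adjoint_inner_right, one_apply_eq_self, inner_self_eq_norm_sq_to_K,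
      inner_self_eq_norm_sq_to_K, sub_nonneg]
    have h1 : ‖η.1 x‖ ≤ ‖x‖ := by
      refine (η.1.le_opNorm x).trans ?_
      have h2 : ‖η.1‖ ≤ 1 := le_of_lt hη
      nlinarith [norm_nonneg x]
    have h2 : ‖η.1 x‖ ^ 2 ≤ ‖x‖ ^ 2 := pow_le_pow_left₀ (norm_nonneg _) h1 2
    exact_mod_cast h2
  have hsa : ContinuousLinearMap.adjoint (defect η).1 = (defect η).1 :=
    (CFC.sqrt_nonneg (1 - ContinuousLinearMap.adjoint η.1 ∘L η.1)).isSelfAdjoint.star_eq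
  rw [hsa]
  exact CFC.sqrt_mul_sqrt_self _ h0

/-- The Poisson kernel intertwines `σ` and `φ_∞(·) ⊗ I_H`. -/
def Intertwiner.poissonKernel (η : Intertwiner R (R.induced φ)) (hη : ‖η‖ < 1) :
    Intertwiner R (R.fockInduced π φ) :=
  Intertwiner.comp (Intertwiner.induced (Fock.leftAct π φ) (defect η))
    (Intertwiner.cauchyKernel π η hη)

/-- `K(η) = Δ_*(η) + (I_E ⊗ K(η)) η`. -/
theorem poissonKernel_eq (η : Intertwiner R (R.induced φ)) (hη : ‖η‖ < 1) :
    (Intertwiner.poissonKernel π η hη).1 = (Intertwiner.vacuum π φ R).1 ∘L (defect η).1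
      + (Intertwiner.shiftMap π φ R).1
        ∘L (Intertwiner.induced φ (Intertwiner.poissonKernel π η hη)).1 ∘L η.1 := by
  have h1 : (Intertwiner.poissonKernel π η hη).1
      = (Intertwiner.induced (Fock.leftAct π φ) (defect η)).1
        ∘L (Intertwiner.cauchyKernel π η hη).1 := rfl
  have h2 : (Intertwiner.induced φ (Intertwiner.poissonKernel π η hη)).1
      = (Intertwiner.induced φ (Intertwiner.induced (Fock.leftAct π φ) (defect η))).1
        ∘L (Intertwiner.induced φ (Intertwiner.cauchyKernel π η hη)).1 :=
    congrArg Subtype.val (Intertwiner.induced_comp φ _ _)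
  have h3 : (Intertwiner.induced (Fock.leftAct π φ) (defect η)).1 ∘L (Intertwiner.vacuum π φ R).1
      = (Intertwiner.vacuum π φ R).1 ∘L (defect η).1 :=
    Intertwiner.induced_comp_tmul _ _ _
  -- $I\otimes\Delta_*$ passes through the vacuum as $\Delta_*$ and through the shift by naturality,
  -- where it merges with $I_E\otimes C(\eta)$ into $I_E\otimes K(\eta)$.
  rw [h1, h2, cauchyKernel_eq, ContinuousLinearMap.comp_add, h3,
    ← ContinuousLinearMap.comp_assoc, induced_comp_shiftMap]
  simp only [ContinuousLinearMap.comp_assoc]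

/-- `K(η)⋆ K(η) = I - η⋆ η + η⋆ (I_E ⊗ K(η)⋆ K(η)) η`. -/
theorem adjoint_poissonKernel_comp_eq (hR : R.act 1 = 1) (η : Intertwiner R (R.induced φ))
    (hη : ‖η‖ < 1) :
    ContinuousLinearMap.adjoint (Intertwiner.poissonKernel π η hη).1
        ∘L (Intertwiner.poissonKernel π η hη).1
      = (ContinuousLinearMap.id ℂ _ - ContinuousLinearMap.adjoint η.1 ∘L η.1)
        + ContinuousLinearMap.adjoint η.1 ∘L (Intertwiner.induced φ (Intertwiner.comp
          (Intertwiner.adj (Intertwiner.poissonKernel π η hη))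
          (Intertwiner.poissonKernel π η hη))).1 ∘L η.1 := by
  have h1 : (Intertwiner.induced φ (Intertwiner.comp
      (Intertwiner.adj (Intertwiner.poissonKernel π η hη)) (Intertwiner.poissonKernel π η hη))).1
      = ContinuousLinearMap.adjoint (Intertwiner.induced φ (Intertwiner.poissonKernel π η hη)).1
        ∘L (Intertwiner.induced φ (Intertwiner.poissonKernel π η hη)).1 := by
    rw [Intertwiner.induced_comp, Intertwiner.induced_adj]
    rfl
  rw [h1]
  set B := (Intertwiner.induced φ (Intertwiner.poissonKernel π η hη)).1
  have hvv := adjoint_vacuum_comp_vacuum φ π hR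
  have hss := adjoint_shiftMap_comp_shiftMap φ π R
  have hvs := adjoint_vacuum_comp_shiftMap φ π R
  have hsv := adjoint_shiftMap_comp_vacuum φ π R
  have hΔ := adjoint_defect_comp_defect η hη
  have hK := poissonKernel_eq π η hη
  change _ = _ + (Intertwiner.shiftMap π φ R).1 ∘L B ∘L η.1 at hK
  rw [hK]
  generalize (Intertwiner.vacuum π φ R).1 = V at *
  generalize (Intertwiner.shiftMap π φ R).1 = S at *
  generalize (defect η).1 = Δ at *
  -- These four relations say that `V` and `S` are isometries with orthogonal ranges, so the cross
  -- terms of $K^*K$ vanish.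
  have e1 : ∀ x, ContinuousLinearMap.adjoint V (V x) = x := fun x => congrArg (fun A => A x) hvv
  have e2 : ∀ x, ContinuousLinearMap.adjoint S (S x) = x := fun x => congrArg (fun A => A x) hss
  have e3 : ∀ x, ContinuousLinearMap.adjoint V (S x) = 0 := fun x => congrArg (fun A => A x) hvs
  have e4 : ∀ x, ContinuousLinearMap.adjoint S (V x) = 0 := fun x => congrArg (fun A => A x) hsv
  rw [← hΔ]
  ext x
  simp only [map_add, ContinuousLinearMap.adjoint_comp, add_apply, ContinuousLinearMap.comp_apply,
    e1, e2, e3, e4, map_zero, add_zero, zero_add]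

/-- The Poisson kernel is an isometry. -/
theorem adjoint_poissonKernel_comp (hR : R.act 1 = 1) (η : Intertwiner R (R.induced φ))
    (hη : ‖η‖ < 1) :
    ContinuousLinearMap.adjoint (Intertwiner.poissonKernel π η hη).1
        ∘L (Intertwiner.poissonKernel π η hη).1 = ContinuousLinearMap.id ℂ _ := by
  let Q : Intertwiner R R := Intertwiner.comp
    (Intertwiner.adj (Intertwiner.poissonKernel π η hη)) (Intertwiner.poissonKernel π η hη)
  have hQ : Q.1 = (ContinuousLinearMap.id ℂ _ - ContinuousLinearMap.adjoint η.1 ∘L η.1)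
      + ContinuousLinearMap.adjoint η.1 ∘L (Intertwiner.induced φ Q).1 ∘L η.1 :=
    adjoint_poissonKernel_comp_eq π hR η hη
  -- The identity solves the equation satisfied by `Q`, so the constant terms cancel in the
  -- difference.
  have h1 : (Q - Intertwiner.id R).1
      = ContinuousLinearMap.adjoint η.1
        ∘L (Intertwiner.induced φ (Q - Intertwiner.id R)).1 ∘L η.1 := by
    rw [Intertwiner.induced_sub, Intertwiner.induced_id]
    change Q.1 - ContinuousLinearMap.id ℂ _ = ContinuousLinearMap.adjoint η.1
      ∘L ((Intertwiner.induced φ Q).1 - ContinuousLinearMap.id ℂ _) ∘L η.1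
    rw [ContinuousLinearMap.sub_comp, ContinuousLinearMap.comp_sub, ContinuousLinearMap.id_comp]
    nth_rw 1 [hQ]
    abel
  have h2 : ‖(Q - Intertwiner.id R).1‖ ≤ ‖η.1‖ * (‖(Q - Intertwiner.id R).1‖ * ‖η.1‖) := by
    conv_lhs => rw [h1]
    refine (ContinuousLinearMap.opNorm_comp_le _ _).trans ?_
    rw [LinearIsometryEquiv.norm_map]
    refine mul_le_mul_of_nonneg_left ((ContinuousLinearMap.opNorm_comp_le _ _).trans ?_)
      (norm_nonneg _)
    exact mul_le_mul_of_nonneg_right (Intertwiner.norm_induced_le φ _) (norm_nonneg _)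
  have h3 : ‖η.1‖ < 1 := hη
  have h4 : ‖(Q - Intertwiner.id R).1‖ = 0 := by
    -- A number $d\ge0$ with $d\le\|\eta\|^2d$ and $\|\eta\|^2<1$ is zero.
    have h5 : ‖η.1‖ * ‖η.1‖ < 1 := by nlinarith [norm_nonneg η.1]
    nlinarith [norm_nonneg (Q - Intertwiner.id R).1]
  exact sub_eq_zero.mp (norm_eq_zero.mp h4)

/-- `(T_ξ⋆ ⊗ I_H) K(η) = K(η) η̂⋆(ξ)⋆`. -/
theorem amp_star_creation_comp_poissonKernel (η : Intertwiner R (R.induced φ)) (hη : ‖η‖ < 1)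
    (ξ : E) :
    R.amp (Fock.leftAct π φ) (star (Fock.creation π φ ξ))
        ∘L (Intertwiner.poissonKernel π η hη).1
      = (Intertwiner.poissonKernel π η hη).1
        ∘L ContinuousLinearMap.adjoint (R.tmul φ ξ) ∘L η.1 := by
  -- In the recursion the vacuum term is annihilated. In the other term the contraction against
  -- $\xi$ commutes past $I_E\otimes K(\eta)$ and meets $\eta$, giving $\widehat{\eta^*}(\xi)^*$.
  conv_lhs => rw [poissonKernel_eq]
  rw [ContinuousLinearMap.comp_add, ← ContinuousLinearMap.comp_assoc,
    amp_star_creation_comp_vacuum, ContinuousLinearMap.zero_comp, zero_add,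
    ← ContinuousLinearMap.comp_assoc, amp_star_creation_comp_shiftMap,
    ← ContinuousLinearMap.comp_assoc, Intertwiner.adjoint_tmul_comp_induced,
    ContinuousLinearMap.comp_assoc]

end PoissonIsometry

/-! ### Ultraweak continuity of normal maps and of matrix coefficients. -/

section IntegratedForm

theorem continuous_ultraweak {A : Type*} [AddCommMonoid A] [Module ℂ A] [Preorder A]
    (ω : A →ₗ[ℂ] ℂ) (hω : ScottContinuous ω) :
    @Continuous A ℂ (ultraweak A) _ ω :=
  continuous_iInf_dom (i := (⟨ω, hω⟩ : {ω : A →ₗ[ℂ] ℂ // ScottContinuous ω}))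
    continuous_induced_dom

/-- Normal linear maps are ultraweakly continuous. -/
theorem ScottContinuous.continuous_ultraweak {A B : Type*} [AddCommMonoid A] [Module ℂ A]
    [Preorder A] [AddCommMonoid B] [Module ℂ B] [Preorder B] (f : A →ₗ[ℂ] B)
    (hf : ScottContinuous f) : @Continuous A B (ultraweak A) (ultraweak B) f := by
  let _ := ultraweak A
  refine continuous_iInf_rng.mpr fun ω => continuous_induced_rng.mpr ?_
  exact HardyPoisson.continuous_ultraweak (ω.1 ∘ₗ f) (hf.comp ω.2)

/-- Matrix coefficients are ultraweakly continuous. -/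
theorem continuous_inner_ultraweak {A H : Type*} [AddCommMonoid A] [Module ℂ A]
    [Preorder A] [NormedAddCommGroup H] [InnerProductSpace ℂ H] [CompleteSpace H]
    (f : A →ₗ[ℂ] (H →L[ℂ] H)) (hf : ScottContinuous f) (x y : H) :
    @Continuous A ℂ (ultraweak A) _ fun a => ⟪x, f a y⟫_ℂ := by
  let _ := ultraweak A
  -- Only diagonal coefficients define functionals known to be normal; the others are reached by
  -- polarization. The conjugations switch between the two slots of the inner product.
  have hq : ∀ z, Continuous fun a => ⟪f a z, z⟫_ℂ := fun z => by
    let ω : A →ₗ[ℂ] ℂ :=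
      { toFun := fun a => ⟪z, f a z⟫_ℂ
        map_add' := fun a b => by rw [map_add, add_apply, inner_add_right]
        map_smul' := fun c a => by
          rw [map_smul, smul_apply, inner_smul_right]
          rfl }
    have h : Continuous fun a => ⟪z, f a z⟫_ℂ :=
      HardyPoisson.continuous_ultraweak ω (hf.comp (scottContinuous_inner z))
    have h' := Complex.continuous_conj.comp h
    exact h'.congr fun a => inner_conj_symm _ _
  have h : Continuous fun a => ⟪f a y, x⟫_ℂ := by
    have := ((((hq (x + y)).sub (hq (x - y))).add
      ((hq (x + Complex.I • y)).const_mul Complex.I)).sub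
      ((hq (x - Complex.I • y)).const_mul Complex.I)).div_const 4
    exact this.congr fun a => (inner_map_polarization (f a : H →ₗ[ℂ] H) x y).symm
  exact (Complex.continuous_conj.comp h).congr fun a => inner_conj_symm _ _

end IntegratedForm

/-! ### The integrated form as a compression. -/

section Transform

variable {M : Type v} [CStarAlgebra M] [PartialOrder M] [StarOrderedRing M] {E : Type u}
  [NormedAddCommGroup E] [NormedSpace ℂ E] [Module Mᵐᵒᵖ E] [HilbertModule M E]
  {φ : M →⋆ₙₐ[ℂ] Adjointable M E}
  {K : Type u} [NormedAddCommGroup K] [InnerProductSpace ℂ K] [CompleteSpace K]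
  {N : VonNeumannAlgebra K} (π : M ≃⋆ₐ[ℂ] N.toStarSubalgebra)
  {R : Rep.{v, w} M}

theorem hardyAlgebra_le {S : NonUnitalSubalgebra ℂ (Adjointable M (Fock π φ))}
    (h1 : ∀ ξ, Fock.creation π φ ξ ∈ S) (h2 : ∀ a, Fock.leftAct π φ a ∈ S)
    (h3 : IsClosed[ultraweak (Adjointable M (Fock π φ))] (S : Set (Adjointable M (Fock π φ)))) :
    hardyAlgebra π φ ≤ S := sInf_le ⟨h1, h2, h3⟩

theorem isClosed_hardyAlgebra :
    IsClosed[ultraweak (Adjointable M (Fock π φ))]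
      (hardyAlgebra π φ : Set (Adjointable M (Fock π φ))) := by
  let _ := ultraweak (Adjointable M (Fock π φ))
  rw [hardyAlgebra, NonUnitalAlgebra.coe_sInf]
  exact isClosed_biInter fun S hS => hS.2.2

theorem Rep.scottContinuous_amp (hR : ScottContinuous R.act) :
    ScottContinuous (R.amp (Fock.leftAct π φ)) := Fock.scottContinuous_amp hR

variable (R) in
/-- For an isometry `V`, the operators `X` for which the range of `V` is invariant under
`X⋆ ⊗ I_H`. -/
def coinvariant {H : Type*} [NormedAddCommGroup H] [InnerProductSpace ℂ H] [CompleteSpace H]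
    (V : H →L[ℂ] (R.fockInduced π φ).space) :
    NonUnitalSubalgebra ℂ (Adjointable M (Fock π φ)) where
  carrier := {X | ContinuousLinearMap.adjoint V ∘L R.amp (Fock.leftAct π φ) X
    = (ContinuousLinearMap.adjoint V ∘L R.amp (Fock.leftAct π φ) X ∘L V)
      ∘L ContinuousLinearMap.adjoint V}
  add_mem' {X Y} hX hY := by
    change _ = _ at hX hY
    change _ = _
    rw [map_add, ContinuousLinearMap.comp_add, ContinuousLinearMap.add_comp,
      ContinuousLinearMap.comp_add, ContinuousLinearMap.add_comp, ← hX, ← hY]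
  zero_mem' := by
    change _ = _
    simp
  smul_mem' c X hX := by
    change _ = _ at hX
    change _ = _
    rw [map_smul, ContinuousLinearMap.comp_smul, ContinuousLinearMap.smul_comp,
      ContinuousLinearMap.comp_smul, ContinuousLinearMap.smul_comp, ← hX]
  mul_mem' {X Y} hX hY := by
    change _ = _ at hX hY
    change _ = _
    -- Membership reads $V^*X=\widehat XV^*$ with $\widehat X=V^*XV$. Using it for `X` and then for
    -- `Y` gives $V^*XY=\widehat X\widehat YV^*$, and multiplying by $V$ on the right identifies the
    -- compression of the product.
    have h1 : ContinuousLinearMap.adjoint V ∘L R.amp (Fock.leftAct π φ) (X * Y)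
        = (ContinuousLinearMap.adjoint V ∘L R.amp (Fock.leftAct π φ) X ∘L V)
          ∘L ContinuousLinearMap.adjoint V ∘L R.amp (Fock.leftAct π φ) Y := by
      rw [map_mul, ← ContinuousLinearMap.comp_assoc _ (ContinuousLinearMap.adjoint V), ← hX,
        ContinuousLinearMap.comp_assoc]
      rfl
    rw [← ContinuousLinearMap.comp_assoc (ContinuousLinearMap.adjoint V), h1]
    conv_lhs => rw [hY]
    simp only [ContinuousLinearMap.comp_assoc]

theorem mem_coinvariant {H : Type*} [NormedAddCommGroup H] [InnerProductSpace ℂ H]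
    [CompleteSpace H] {V : H →L[ℂ] (R.fockInduced π φ).space}
    {X : Adjointable M (Fock π φ)} :
    X ∈ coinvariant π R V ↔ ContinuousLinearMap.adjoint V ∘L R.amp (Fock.leftAct π φ) X
      = (ContinuousLinearMap.adjoint V ∘L R.amp (Fock.leftAct π φ) X ∘L V)
        ∘L ContinuousLinearMap.adjoint V := Iff.rfl

/-- For an isometry, $V^*X=TV^*$ forces $T=TV^*V=V^*XV$, so any such `T` is the compression. -/
theorem mem_coinvariant_of_comp_eq {H : Type*} [NormedAddCommGroup H] [InnerProductSpace ℂ H]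
    [CompleteSpace H] {V : H →L[ℂ] (R.fockInduced π φ).space}
    (hV : ContinuousLinearMap.adjoint V ∘L V = ContinuousLinearMap.id ℂ H)
    {X : Adjointable M (Fock π φ)} {T : H →L[ℂ] H}
    (h : ContinuousLinearMap.adjoint V ∘L R.amp (Fock.leftAct π φ) X
      = T ∘L ContinuousLinearMap.adjoint V) : X ∈ coinvariant π R V := by
  rw [mem_coinvariant, ← ContinuousLinearMap.comp_assoc _ (R.amp (Fock.leftAct π φ) X), h,
    ContinuousLinearMap.comp_assoc T, hV, ContinuousLinearMap.comp_id]

/-- The defining equation is an equality of matrix coefficients of $X\otimes I_H$, all ultraweakly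
continuous in $X$ since amplification is normal. -/
theorem isClosed_coinvariant (hR : ScottContinuous R.act) {H : Type*} [NormedAddCommGroup H]
    [InnerProductSpace ℂ H] [CompleteSpace H] (V : H →L[ℂ] (R.fockInduced π φ).space) :
    IsClosed[ultraweak (Adjointable M (Fock π φ))]
      (coinvariant π R V : Set (Adjointable M (Fock π φ))) := by
  let _ := ultraweak (Adjointable M (Fock π φ))
  let L : Adjointable M (Fock π φ) →ₗ[ℂ]
      ((R.fockInduced π φ).space →L[ℂ] (R.fockInduced π φ).space) :=
    { toFun := R.amp (Fock.leftAct π φ)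
      map_add' := map_add _
      map_smul' := map_smul _ }
  have hc : ∀ x y, Continuous fun X => ⟪x, R.amp (Fock.leftAct π φ) X y⟫_ℂ :=
    continuous_inner_ultraweak L (Rep.scottContinuous_amp π hR)
  have h : (coinvariant π R V : Set (Adjointable M (Fock π φ)))
      = ⋂ (x : H) (y : (R.fockInduced π φ).space), {X |
        ⟪V x, R.amp (Fock.leftAct π φ) X y⟫_ℂ
          = ⟪V x, R.amp (Fock.leftAct π φ) X (V (ContinuousLinearMap.adjoint V y))⟫_ℂ} := by
    ext X
    simp only [Set.mem_iInter, Set.mem_ofPred_eq, SetLike.mem_coe, mem_coinvariant]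
    simp only [← ContinuousLinearMap.adjoint_inner_right V]
    refine ⟨fun h x y => congrArg (fun A => ⟪x, A y⟫_ℂ) h, fun h => ?_⟩
    exact ContinuousLinearMap.ext fun y => ext_inner_left ℂ fun x => h x y
  rw [h]
  exact isClosed_iInter fun x => isClosed_iInter fun y => isClosed_eq (hc _ _) (hc _ _)

section

variable (hR : ScottContinuous R.act) (hR1 : R.act 1 = 1) (η : Intertwiner R (R.induced φ))
  (hη : ‖η‖ < 1)

theorem adjoint_poissonKernel_comp_creation (ξ : E) :
    ContinuousLinearMap.adjoint (Intertwiner.poissonKernel π η hη).1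
        ∘L R.amp (Fock.leftAct π φ) (Fock.creation π φ ξ)
      = (ContinuousLinearMap.adjoint η.1 ∘L R.tmul φ ξ)
        ∘L ContinuousLinearMap.adjoint (Intertwiner.poissonKernel π η hη).1 := by
  have h := congrArg ContinuousLinearMap.adjoint
    (amp_star_creation_comp_poissonKernel π η hη ξ)
  rw [ContinuousLinearMap.adjoint_comp, ContinuousLinearMap.adjoint_comp,
    ContinuousLinearMap.adjoint_comp, ContinuousLinearMap.adjoint_adjoint, map_star,
    ContinuousLinearMap.star_eq_adjoint, ContinuousLinearMap.adjoint_adjoint] at h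
  exact h

theorem adjoint_poissonKernel_comp_leftAct (a : M) :
    ContinuousLinearMap.adjoint (Intertwiner.poissonKernel π η hη).1
        ∘L R.amp (Fock.leftAct π φ) (Fock.leftAct π φ a)
      = R.act a ∘L ContinuousLinearMap.adjoint (Intertwiner.poissonKernel π η hη).1 :=
  (Intertwiner.adj (Intertwiner.poissonKernel π η hη)).2 a

/-- The generators satisfy $K^*(X\otimes I)=TK^*$ with $T=\widehat{\eta^*}(\xi)$ or $\sigma(a)$.
Minimality of $H^\infty(E)$ extends coinvariance to all of it. -/
theorem hardyAlgebra_le_coinvariant (hR : ScottContinuous R.act) (hR1 : R.act 1 = 1)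
    (η : Intertwiner R (R.induced φ)) (hη : ‖η‖ < 1) :
    hardyAlgebra π φ ≤ coinvariant π R (Intertwiner.poissonKernel π η hη).1 :=
  hardyAlgebra_le π
    (fun ξ => mem_coinvariant_of_comp_eq π (adjoint_poissonKernel_comp π hR1 η hη)
      (adjoint_poissonKernel_comp_creation π η hη ξ))
    (fun a => mem_coinvariant_of_comp_eq π (adjoint_poissonKernel_comp π hR1 η hη)
      (adjoint_poissonKernel_comp_leftAct π η hη a))
    (isClosed_coinvariant π hR _)

/-- The compression `X ↦ K(η)⋆ (X ⊗ I_H) K(η)` as a linear map. -/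
def compression : Adjointable M (Fock π φ) →ₗ[ℂ] (R.space →L[ℂ] R.space) where
  toFun X := ContinuousLinearMap.adjoint (Intertwiner.poissonKernel π η hη).1
    ∘L R.amp (Fock.leftAct π φ) X ∘L (Intertwiner.poissonKernel π η hη).1
  map_add' X Y := by
    rw [map_add, ContinuousLinearMap.add_comp, ContinuousLinearMap.comp_add]
  map_smul' c X := by
    rw [map_smul, ContinuousLinearMap.smul_comp, ContinuousLinearMap.comp_smul]
    rfl

theorem compression_apply (X : Adjointable M (Fock π φ)) :
    compression π η hη X = ContinuousLinearMap.adjoint (Intertwiner.poissonKernel π η hη).1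
      ∘L R.amp (Fock.leftAct π φ) X ∘L (Intertwiner.poissonKernel π η hη).1 := rfl

/-- The integrated form as a compression by the Poisson kernel. -/
def integratedForm : hardyAlgebra π φ →ₙₐ[ℂ] (R.space →L[ℂ] R.space) where
  toFun X := compression π η hη X.1
  map_zero' := map_zero (compression π η hη)
  map_add' X Y := map_add (compression π η hη) X.1 Y.1
  map_smul' c X := map_smul (compression π η hη) c X.1
  map_mul' X Y := by
    -- A compression is not multiplicative in general; here $K^*(X\otimes I)=\widehat XK^*$ lets the
    -- factor $\widehat X$ be pulled out of $K^*(XY\otimes I)K$.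
    have hX := hardyAlgebra_le_coinvariant π hR hR1 η hη X.2
    rw [mem_coinvariant, ← compression_apply] at hX
    change compression π η hη (X.1 * Y.1) = compression π η hη X.1 ∘L compression π η hη Y.1
    rw [compression_apply, map_mul]
    change ContinuousLinearMap.adjoint (Intertwiner.poissonKernel π η hη).1
      ∘L (R.amp (Fock.leftAct π φ) X.1 ∘L R.amp (Fock.leftAct π φ) Y.1)
      ∘L (Intertwiner.poissonKernel π η hη).1 = _
    rw [← ContinuousLinearMap.comp_assoc, ← ContinuousLinearMap.comp_assoc, hX,
      compression_apply π η hη Y.1]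
    simp only [ContinuousLinearMap.comp_assoc]

theorem isIntegratedForm_integratedForm :
    IsIntegratedForm π η (integratedForm π hR hR1 η hη) where
  map_leftAct a := by
    change compression π η hη (Fock.leftAct π φ a) = _
    rw [compression_apply, ← ContinuousLinearMap.comp_assoc, adjoint_poissonKernel_comp_leftAct,
      ContinuousLinearMap.comp_assoc, adjoint_poissonKernel_comp π hR1,
      ContinuousLinearMap.comp_id]
  map_creation ξ := by
    change compression π η hη (Fock.creation π φ ξ) = _
    rw [compression_apply, ← ContinuousLinearMap.comp_assoc, adjoint_poissonKernel_comp_creation,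
      ContinuousLinearMap.comp_assoc, adjoint_poissonKernel_comp π hR1,
      ContinuousLinearMap.comp_id]
    rfl
  continuous := by
    let _ := ultraweak (Adjointable M (Fock π φ))
    let _ := ultraweak (R.space →L[ℂ] R.space)
    have h : ScottContinuous (compression π η hη) :=
      (Rep.scottContinuous_amp π hR).comp
        (scottContinuous_conj (Intertwiner.poissonKernel π η hη).1)
    exact (ScottContinuous.continuous_ultraweak _ h).comp continuous_induced_dom

end

/-! ### Uniqueness of the integrated form and the Fourier transform formulas. -/

theorem t2Space_ultraweak {H : Type*} [NormedAddCommGroup H] [InnerProductSpace ℂ H]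
    [CompleteSpace H] : @T2Space (H →L[ℂ] H) (ultraweak (H →L[ℂ] H)) := by
  refine @T2Space.mk _ (ultraweak _) fun S T hST => ?_
  obtain ⟨x, y, hxy⟩ : ∃ x y, ⟪x, S y⟫_ℂ ≠ ⟪x, T y⟫_ℂ := by
    by_contra! h
    exact hST (ContinuousLinearMap.ext fun y => ext_inner_left ℂ fun x => h x y)
  exact @separated_by_continuous _ _ (ultraweak _) _ _ _
    (continuous_inner_ultraweak LinearMap.id ScottContinuous.id x y) _ _ hxy

/-- The equalizer lives inside the subalgebra; its image in the ambient algebra is what minimality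
of $H^\infty(E)$ can be applied to. -/
theorem mem_map_subtype_equalizer {A B : Type*} [NonUnitalRing A] [Module ℂ A]
    [NonUnitalRing B] [Module ℂ B] [IsScalarTower ℂ A A] [SMulCommClass ℂ A A]
    {S : NonUnitalSubalgebra ℂ A} (ρ ρ' : S →ₙₐ[ℂ] B) (X : S) :
    X.1 ∈ (NonUnitalAlgHom.equalizer ρ ρ').map (NonUnitalSubalgebraClass.subtype S)
      ↔ ρ X = ρ' X := by
  refine ⟨?_, fun hX => ⟨X, hX, rfl⟩⟩
  rintro ⟨Y, hY, hYX⟩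
  have h : Y = X := Subtype.ext hYX
  rwa [← h]

/-- Both maps are continuous into $B(H)$ with its ultraweak topology, which is Hausdorff because
matrix coefficients separate operators. -/
theorem IsIntegratedForm.isClosed_equalizer {η : Intertwiner R (R.induced φ)}
    {ρ ρ' : hardyAlgebra π φ →ₙₐ[ℂ] (R.space →L[ℂ] R.space)}
    (h : IsIntegratedForm π η ρ) (h' : IsIntegratedForm π η ρ') :
    IsClosed[(ultraweak (Adjointable M (Fock π φ))).induced Subtype.val]
      {X : hardyAlgebra π φ | ρ X = ρ' X} :=
  @isClosed_eq _ _ (ultraweak _) (.induced _ (ultraweak _)) t2Space_ultraweak _ _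
    h.continuous h'.continuous

/-- The integrated form is unique. -/
theorem IsIntegratedForm.unique {η : Intertwiner R (R.induced φ)}
    {ρ ρ' : hardyAlgebra π φ →ₙₐ[ℂ] (R.space →L[ℂ] R.space)}
    (h : IsIntegratedForm π η ρ) (h' : IsIntegratedForm π η ρ') : ρ = ρ' := by
  obtain ⟨S, hmem, hS⟩ : ∃ S : NonUnitalSubalgebra ℂ (Adjointable M (Fock π φ)),
      (∀ X : hardyAlgebra π φ, X.1 ∈ S ↔ ρ X = ρ' X) ∧
        (S : Set (Adjointable M (Fock π φ))) = Subtype.val '' {X | ρ X = ρ' X} :=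
    ⟨_, mem_map_subtype_equalizer ρ ρ', rfl⟩
  have hclosed : IsClosed[ultraweak (Adjointable M (Fock π φ))]
      (S : Set (Adjointable M (Fock π φ))) := by
    rw [hS]
    let _ := ultraweak (Adjointable M (Fock π φ))
    -- Relatively closed subsets of $H^\infty(E)$ are closed in $\mathcal L(\mathcal F(E))$ because
    -- $H^\infty(E)$ itself is.
    exact (isClosed_hardyAlgebra π).isClosedMap_subtype_val _ (h.isClosed_equalizer π h')
  have hle : hardyAlgebra π φ ≤ S := by
    refine hardyAlgebra_le π (fun ξ => ?_) (fun a => ?_) hclosed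
    · refine (hmem ⟨_, creation_mem_hardyAlgebra π φ ξ⟩).mpr ?_
      rw [h.map_creation, h'.map_creation]
    · refine (hmem ⟨_, leftAct_mem_hardyAlgebra π φ a⟩).mpr ?_
      rw [h.map_leftAct, h'.map_leftAct]
  exact NonUnitalAlgHom.ext fun X => (hmem X).mp (hle X.2)

/-- The transform is defined through a chosen integrated form; uniqueness makes the choice
immaterial. -/
theorem fourierTransform_eq {η : Intertwiner R (R.induced φ)}
    {ρ : hardyAlgebra π φ →ₙₐ[ℂ] (R.space →L[ℂ] R.space)} (h : IsIntegratedForm π η ρ)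
    (X : hardyAlgebra π φ) : fourierTransform π X η = ρ X := by
  have h' : ∃ ρ, IsIntegratedForm π η ρ := ⟨ρ, h⟩
  rw [fourierTransform, dif_pos h', h'.choose_spec.unique π h]

/-- The adjoint of $K^*(X\otimes I)=\widehat XK^*$. -/
theorem poissonKernel_comp_adjoint_compression (hR : ScottContinuous R.act) (hR1 : R.act 1 = 1)
    (η : Intertwiner R (R.induced φ)) (hη : ‖η‖ < 1) (X : hardyAlgebra π φ) :
    (Intertwiner.poissonKernel π η hη).1 ∘L ContinuousLinearMap.adjoint (compression π η hη X)
      = R.amp (Fock.leftAct π φ) (star X.1) ∘L (Intertwiner.poissonKernel π η hη).1 := by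
  have hX := hardyAlgebra_le_coinvariant π hR hR1 η hη X.2
  rw [mem_coinvariant, ← compression_apply] at hX
  have h := congrArg ContinuousLinearMap.adjoint hX
  rw [ContinuousLinearMap.adjoint_comp, ContinuousLinearMap.adjoint_comp,
    ContinuousLinearMap.adjoint_adjoint, ← ContinuousLinearMap.star_eq_adjoint (R.amp _ _),
    ← map_star] at h
  exact h.symm

end Transform

end HardyPoisson

end

open HardyPoisson
theorem theorem3p4 {M : Type v} [CStarAlgebra M] [PartialOrder M] [StarOrderedRing M]
    {K : Type u} [NormedAddCommGroup K] [InnerProductSpace ℂ K] [CompleteSpace K]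
    {N : VonNeumannAlgebra K} (π : M ≃⋆ₐ[ℂ] N.toStarSubalgebra)
    {E : Type u} [NormedAddCommGroup E] [NormedSpace ℂ E] [Module Mᵐᵒᵖ E] [HilbertModule M E]
    [CompleteSpace E] (hE : SelfDual M E)
    (φ : M →⋆ₙₐ[ℂ] Adjointable M E) (hφ : ScottContinuous φ)
    (σ : HardyPoisson.Rep.{v, w} M) (hσ : ScottContinuous σ.act) (hσ1 : σ.act 1 = 1)
    (η : Intertwiner σ (σ.induced φ)) (hη : ‖η‖ < 1) :
    (∃! ρ : hardyAlgebra π φ →ₙₐ[ℂ] (σ.space →L[ℂ] σ.space), IsIntegratedForm π η ρ) ∧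
      ∀ X : hardyAlgebra π φ,
        HardyPoisson.poissonKernel π η ∘L ContinuousLinearMap.adjoint (fourierTransform π X η)
            = Tensor.amp σ (star (X : Adjointable M (Fock π φ))) ∘L HardyPoisson.poissonKernel π η ∧
          fourierTransform π X η
            = ContinuousLinearMap.adjoint (HardyPoisson.poissonKernel π η)
                ∘L Tensor.amp σ (X : Adjointable M (Fock π φ)) ∘L HardyPoisson.poissonKernel π η := by
  have h := isIntegratedForm_integratedForm π hσ hσ1 η hη
  refine ⟨⟨_, h, fun ρ hρ => hρ.unique π h⟩, fun X => ?_⟩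
  have hX : fourierTransform π X η = compression π η hη X := fourierTransform_eq π h X
  rw [hX]
  exact ⟨poissonKernel_comp_adjoint_compression π hσ hσ1 η hη X, rfl⟩
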